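/- Let $C$ be a smooth projective curve over $\mathbb{C}$, let $L$ be a line bundle on $C$, written $L=\mathcal{O}_C(D)$ for a divisor $D$, and let $V\subseteq H^0(C,L)$ be a linear subspace of dimension $3$ (a linear series of rank $2$) that generates $L$, that is, $V\otimes\mathcal{O}_C\to L$ is surjective. Let $\varphi_{|V|}\colon C\to\mathbb{P}^2$, $x\mapsto[s_0(x):s_1(x):s_2(x)]$, be the morphism given by a basis $s_0,s_1,s_2$ of $V$, let $\overline{C}\subset\mathbb{P}^2$ be its image, and assume that $\varphi_{|V|}\colon C\to\overline{C}$ is birational. For a linear series $|W|$ put $\mathrm{rk}|W|=\dim W-1$; the line bundle generated by $W\subseteq H^0(C,L)$ is the image $L'\subseteq L$ of $W\otimes\mathcal{O}_C\to L$. The series $|V|$ is called linearly stable (respectively linearly semistable) if for every subspace $W\subsetneq V$ with $\dim W\ge 2$ the line bundle $L'$ generated by $W$ satisfies $$\frac{\deg L'}{\mathrm{rk}|W|}>\frac{\deg L}{\mathrm{rk}|V|}\qquad\Bigl(\text{respectively } \frac{\deg L'}{\mathrm{rk}|W|}\ge\frac{\deg L}{\mathrm{rk}|V|}\Bigr).$$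 For a (closed) point $p\in\overline{C}$ let $m_p(\overline{C})$ be the multiplicity of the plane curve $\overline{C}$ at $p$, i.e. the largest $m$ such that the ideal of $\overline{C}$ in $\mathcal{O}_{\mathbb{P}^2,p}$ is contained in $\mathfrak{m}_p^m$. Then $|V|$ is linearly stable if and only if $m_p(\overline{C})<\deg L/2$ for all points $p\in\overline{C}$, and $|V|$ is linearly semistable if and only if $m_p(\overline{C})\le\deg L/2$ for all points $p\in\overline{C}$. -/

import Mathlib

open AlgebraicGeometry CategoryTheory

noncomputable section

namespace LinearSeries

/-- A smooth projective curve over `ℂ`: an integral scheme, proper and smooth of relative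
dimension one over `Spec ℂ`. (For such schemes proper and projective are equivalent.) -/
class IsSmoothProjectiveCurve (C : Scheme.{0}) [C.Over (Spec (.of ℂ))] : Prop where
  isIntegral : IsIntegral C
  isProper : IsProper (C ↘ Spec (.of ℂ))
  smooth : SmoothOfRelativeDimension 1 (C ↘ Spec (.of ℂ))

attribute [instance] IsSmoothProjectiveCurve.isIntegral IsSmoothProjectiveCurve.isProper
  IsSmoothProjectiveCurve.smooth

variable (C : Scheme.{0}) [C.Over (Spec (.of ℂ))] [IsSmoothProjectiveCurve C]

instance isLocallyNoetherian_curve : IsLocallyNoetherian C :=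
  LocallyOfFiniteType.isLocallyNoetherian (C ↘ Spec (.of ℂ))

/-- The function field `K(C)` is an extension of `ℂ`, through the structure morphism. -/
instance algebraFunctionField : Algebra ℂ C.functionField :=
  ((C.presheaf.germ ⊤ (genericPoint C) trivial).hom.comp
    ((C ↘ Spec (.of ℂ)).appTop.hom.comp (Scheme.ΓSpecIso (.of ℂ)).inv.hom)).toAlgebra

/-- A divisor on `C`: a finite formal integral combination of closed points. -/
abbrev Divisor : Type := {x : C // IsClosed {x}} →₀ ℤ

variable {C}

/-- The degree of a divisor `D`, which is the degree of the line bundle `𝒪_C(D)`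
(all closed points have residue field `ℂ`). -/
def Divisor.degree (D : Divisor C) : ℤ := D.sum fun _ n => n

/-- The stalk at the closed point `x` of the line bundle `𝒪_C(D)`, as a subset of `K(C)`:
the rational functions `f` with `f = 0` or `ord_x f + D x ≥ 0`. -/
def lineBundleStalk (D : Divisor C) (x : {x : C // IsClosed {x}}) : Set C.functionField :=
  {f | f = 0 ∨ 0 ≤ C.ord f x.1 + D x}

/-- The global sections `H⁰(C, 𝒪_C(D))` of the line bundle `𝒪_C(D)`. -/
def globalSections (D : Divisor C) : Set C.functionField :=
  {f | ∀ x, f ∈ lineBundleStalk D x}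

/-- The space `W` of rational functions generates the line bundle `𝒪_C(D)`: the image of
`W ⊗ 𝒪_C` in the constant sheaf `K(C)` is `𝒪_C(D)`. This is checked on the stalks at the closed
points `x`, where that image is the `𝒪_{C, x}`-submodule of `K(C)` spanned by `W`. -/
def Generates (W : Submodule ℂ C.functionField) (D : Divisor C) : Prop :=
  ∀ x : {x : C // IsClosed {x}},
    (Submodule.span (C.presheaf.stalk x.1) (W : Set C.functionField) : Set C.functionField) =
      lineBundleStalk D x

/-- The rank `dim V - 1` of the linear series `|V|`. -/
def rk (V : Submodule ℂ C.functionField) : ℤ := (Module.finrank ℂ V : ℤ) - 1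

/-- Linear stability of a generating pair `(𝒪_C(D), V)`: for every proper subspace `W` of `V` with
`dim W ≥ 2`, the line bundle `L' = 𝒪_C(D')` generated by `W` satisfies
`deg L' / rk |W| > deg L / rk |V|`. -/
def IsLinearlyStable (D : Divisor C) (V : Submodule ℂ C.functionField) : Prop :=
  ∀ W : Submodule ℂ C.functionField, W < V → 2 ≤ Module.finrank ℂ W →
    ∀ D' : Divisor C, Generates W D' →
      (D'.degree : ℚ) / (rk W : ℚ) > (D.degree : ℚ) / (rk V : ℚ)

/-- Linear semistability of a generating pair `(𝒪_C(D), V)`. -/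
def IsLinearlySemistable (D : Divisor C) (V : Submodule ℂ C.functionField) : Prop :=
  ∀ W : Submodule ℂ C.functionField, W < V → 2 ≤ Module.finrank ℂ W →
    ∀ D' : Divisor C, Generates W D' →
      (D'.degree : ℚ) / (rk W : ℚ) ≥ (D.degree : ℚ) / (rk V : ℚ)

attribute [local instance] MvPolynomial.gradedAlgebra

/-- The projective plane over `ℂ`. -/
abbrev Plane : Scheme.{0} := Proj (MvPolynomial.homogeneousSubmodule (Fin 3) ℂ)

/-- Evaluation of polynomials at a triple of rational functions, with values in
`Γ(Spec K(C), ⊤) = K(C)`. -/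
def evalTriple (s : Fin 3 → C.functionField) :
    MvPolynomial (Fin 3) ℂ →+* Γ(Spec C.functionField, ⊤) :=
  (Scheme.ΓSpecIso C.functionField).inv.hom.comp (MvPolynomial.aeval s).toRingHom

theorem map_irrelevant_evalTriple (s : Fin 3 → C.functionField) (hs : s ≠ 0) :
    (HomogeneousIdeal.irrelevant (MvPolynomial.homogeneousSubmodule (Fin 3) ℂ)).toIdeal.map
      (evalTriple s) = ⊤ := by
  obtain ⟨i, hi⟩ : ∃ i, s i ≠ 0 := by
    by_contra! h
    exact hs (funext h)
  refine Ideal.eq_top_of_isUnit_mem _ (Ideal.mem_map_of_mem _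
    (x := (MvPolynomial.X i : MvPolynomial (Fin 3) ℂ)) ?_) ?_
  · exact HomogeneousIdeal.mem_irrelevant_of_mem _ one_pos (MvPolynomial.isHomogeneous_X ℂ i)
  · have h : IsUnit (MvPolynomial.aeval s (MvPolynomial.X i : MvPolynomial (Fin 3) ℂ)) := by
      simpa using hi
    exact h.map (Scheme.ΓSpecIso C.functionField).inv.hom

/-- The `K(C)`-valued point `[s₀ : s₁ : s₂]` of the projective plane. -/
def genericCoordinates (s : Fin 3 → C.functionField) (hs : s ≠ 0) :
    Spec C.functionField ⟶ Plane :=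
  Proj.fromOfGlobalSections (MvPolynomial.homogeneousSubmodule (Fin 3) ℂ) (evalTriple s)
    (map_irrelevant_evalTriple s hs)

theorem basis_ne_zero {V : Submodule ℂ C.functionField} (b : Module.Basis (Fin 3) ℂ V) :
    (fun i => (b i : C.functionField)) ≠ 0 := fun h =>
  b.ne_zero 0 (Subtype.ext (congrFun h 0))

/-- `φ` is the morphism `φ_{|V|} : C ⟶ ℙ²`, `x ↦ [s₀(x) : s₁(x) : s₂(x)]`, in the homogeneous
coordinates given by a basis `s₀, s₁, s₂` of `V`: it is the (unique) morphism whose restriction to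
the generic point of `C` is the `K(C)`-valued point `[s₀ : s₁ : s₂]`. -/
def IsMapOfSeries {V : Submodule ℂ C.functionField} (b : Module.Basis (Fin 3) ℂ V)
    (φ : C ⟶ Plane) : Prop :=
  C.fromSpecStalk (genericPoint C) ≫ φ =
    genericCoordinates (fun i => (b i : C.functionField)) (basis_ne_zero b)

/-- A morphism is birational if it restricts to an isomorphism between dense open subschemes. -/
def IsBirationalMorphism {X Y : Scheme.{0}} (f : X ⟶ Y) : Prop :=
  ∃ e : X.PartialIso Y, e.toRationalMap = f.toPartialMap.toRationalMap

/-- The multiplicity at the point `p` of the scheme-theoretic image `Z` of `φ : C ⟶ ℙ²`: the order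
at `p` of the ideal of the plane curve `Z`, that is, the largest `m` such that the kernel of
`𝒪_{ℙ², p} ⟶ 𝒪_{Z, p}` lies in the `m`-th power of the maximal ideal of `𝒪_{ℙ², p}`. -/
def imageMultiplicity (φ : C ⟶ Plane) (p : φ.image) : ℕ :=
  sSup {m : ℕ | RingHom.ker (φ.imageι.stalkMap p).hom ≤
    IsLocalRing.maximalIdeal (Plane.presheaf.stalk (φ.imageι p)) ^ m}

end LinearSeries

end

/-!
A two-dimensional `W ⊂ V` is a pencil of lines, so it consists of the lines through a point of the
plane. Without a base point on `C` it generates `L`, and `deg L' = deg L`. If it has a base point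
`x`, it is the pencil of lines through `p = φ(x)`, and then `deg L' = deg L - m_p`: the degree of
`L'` is the degree of the projection from `p`, which is `[K(C) : ℂ(g)]` for the slope `g` of the
lines through `p`. The curve is birational to its image, so this is the degree in the other variable
of the strict transform of an equation `f` of the image, namely `deg f - m_p`. Projecting from a
point off the curve in the same way gives `deg L = deg f`. As `rk |W| = 1` and `rk |V| = 2`,
stability says exactly that `deg L - m_p > deg L / 2` for all `p`.

The degree of a map to the line is counted on its zeros, by identifying the closed points of `C`
with the valuation rings of `K(C)` over `ℂ`; this is the valuative criterion of properness.
-/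

noncomputable section

namespace LinearSeries

section PlaneCurvePolynomials

open Polynomial

section Radial

variable {R : Type*} [CommSemiring R]

/-- The order of vanishing at the origin of a polynomial in two variables, which is the multiplicity
at the origin of the plane curve with that equation. The zero polynomial gets the order `0`. -/
def orderAtOrigin (p : MvPolynomial (Fin 2) R) : ℕ :=
  sSup {n | p ∈ MvPolynomial.idealOfVars (Fin 2) R ^ n}

variable (R) in
/-- The substitution `f(X, Y) ↦ f(X, G X)`, with `G` the slope of a line through the origin. The
outer variable of `R[X][X]` is `X`, so that its powers record the total degree, and the inner
variable is `G`. -/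
def radial : MvPolynomial (Fin 2) R →ₐ[R] R[X][X] :=
  MvPolynomial.aeval ![X, C X * X]

theorem radial_X_zero : radial R (MvPolynomial.X 0) = X := by simp [radial]

theorem radial_X_one : radial R (MvPolynomial.X 1) = C X * X := by simp [radial]

theorem radial_C (c : R) : radial R (MvPolynomial.C c) = C (C c) :=
  MvPolynomial.aeval_C _ c

theorem radial_monomial (e : Fin 2 →₀ ℕ) (c : R) :
    radial R (MvPolynomial.monomial e c) = monomial e.degree (monomial (e 1) c) := by
  rw [MvPolynomial.monomial_eq, Finsupp.prod_fintype _ _ (by simp), Fin.prod_univ_two, map_mul,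
    map_mul, map_pow, map_pow, radial_C, radial_X_zero, radial_X_one, Finsupp.degree_eq_sum,
    Fin.sum_univ_two, ← C_mul_X_pow_eq_monomial, ← C_mul_X_pow_eq_monomial, C_mul, C_pow]
  ring

theorem coeff_coeff_radial (p : MvPolynomial (Fin 2) R) (e : Fin 2 →₀ ℕ) :
    ((radial R p).coeff e.degree).coeff (e 1) = p.coeff e := by
  induction p using MvPolynomial.induction_on' with
  | monomial e' c =>
    have he : e' = e ↔ e'.degree = e.degree ∧ e' 1 = e 1 := by
      simp only [Finsupp.degree_eq_sum, Fin.sum_univ_two, Finsupp.ext_iff, Fin.forall_fin_two]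
      omega
    rw [radial_monomial, coeff_monomial, MvPolynomial.coeff_monomial]
    split_ifs <;> simp_all [coeff_monomial]
  | add p q hp hq => simp only [map_add, coeff_add, MvPolynomial.coeff_add, hp, hq]

theorem coeff_radial_eq_zero_iff {p : MvPolynomial (Fin 2) R} {n : ℕ} :
    (radial R p).coeff n = 0 ↔ ∀ e : Fin 2 →₀ ℕ, e.degree = n → p.coeff e = 0 := by
  refine ⟨fun h e he => by rw [← coeff_coeff_radial, he, h, coeff_zero], fun h => ?_⟩
  rw [← MvPolynomial.support_sum_monomial_coeff p, map_sum, finsetSum_coeff]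
  refine Finset.sum_eq_zero fun e he => ?_
  rw [radial_monomial, coeff_monomial, if_neg]
  exact fun hd => MvPolynomial.mem_support_iff.mp he (h e hd)

theorem radial_eq_zero_iff {p : MvPolynomial (Fin 2) R} : radial R p = 0 ↔ p = 0 := by
  refine ⟨fun h => ?_, fun h => by rw [h, map_zero]⟩
  ext e
  rw [← coeff_coeff_radial, h, coeff_zero, coeff_zero, MvPolynomial.coeff_zero]

theorem mem_pow_idealOfVars_iff_X_pow_dvd_radial (p : MvPolynomial (Fin 2) R) (n : ℕ) :
    p ∈ MvPolynomial.idealOfVars (Fin 2) R ^ n ↔ X ^ n ∣ radial R p := by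
  simp only [MvPolynomial.mem_pow_idealOfVars_iff', X_pow_dvd_iff, coeff_radial_eq_zero_iff]
  exact ⟨fun h d hd e he => h e (he ▸ hd), fun h e he => h _ he e rfl⟩

theorem natDegree_radial (p : MvPolynomial (Fin 2) R) :
    (radial R p).natDegree = p.totalDegree := by
  apply le_antisymm
  · rw [natDegree_le_iff_coeff_eq_zero]
    refine fun n hn => coeff_radial_eq_zero_iff.mpr fun e he => ?_
    exact MvPolynomial.coeff_eq_zero_of_totalDegree_lt (he ▸ hn : p.totalDegree < e.degree)
  · refine Finset.sup_le fun e he => le_natDegree_of_ne_zero fun h => ?_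
    exact MvPolynomial.mem_support_iff.mp he (coeff_radial_eq_zero_iff.mp h e rfl)

theorem natTrailingDegree_radial {p : MvPolynomial (Fin 2) R} (hp : p ≠ 0) :
    (radial R p).natTrailingDegree = orderAtOrigin p := by
  have h0 : radial R p ≠ 0 := radial_eq_zero_iff.not.mpr hp
  have : {n | p ∈ MvPolynomial.idealOfVars (Fin 2) R ^ n} =
      Set.Iic (radial R p).natTrailingDegree := by
    ext n
    rw [Set.mem_ofPred_eq, mem_pow_idealOfVars_iff_X_pow_dvd_radial, Set.mem_Iic, X_pow_dvd_iff]
    exact ⟨fun h => le_natTrailingDegree h0 h,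
      fun h d hd => coeff_eq_zero_of_lt_natTrailingDegree (hd.trans_le h)⟩
  rw [orderAtOrigin, this, csSup_Iic]

theorem orderAtOrigin_eq_zero_of_constantCoeff_ne_zero {p : MvPolynomial (Fin 2) R}
    (hp : MvPolynomial.constantCoeff p ≠ 0) : orderAtOrigin p = 0 := by
  rw [← natTrailingDegree_radial fun h => hp (by rw [h, map_zero])]
  refine natTrailingDegree_eq_zero_of_constantCoeff_ne_zero fun h => hp ?_
  exact coeff_radial_eq_zero_iff.mp h 0 (map_zero _)

theorem exists_radial_eq_X_pow_mul (q : R[X][X]) : ∃ N p, radial R p = X ^ N * q := by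
  have hadd : ∀ q₁ q₂ : R[X][X], (∃ N p, radial R p = X ^ N * q₁) →
      (∃ N p, radial R p = X ^ N * q₂) → ∃ N p, radial R p = X ^ N * (q₁ + q₂) := by
    rintro q₁ q₂ ⟨N₁, p₁, h₁⟩ ⟨N₂, p₂, h₂⟩
    refine ⟨N₁ + N₂, MvPolynomial.X 0 ^ N₂ * p₁ + MvPolynomial.X 0 ^ N₁ * p₂, ?_⟩
    rw [map_add, map_mul, map_mul, map_pow, map_pow, radial_X_zero, h₁, h₂]
    ring
  induction q using Polynomial.induction_on' with
  | add q₁ q₂ h₁ h₂ => exact hadd q₁ q₂ h₁ h₂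
  | monomial n a =>
    induction a using Polynomial.induction_on' with
    | add a₁ a₂ h₁ h₂ =>
      rw [map_add]
      exact hadd _ _ h₁ h₂
    | monomial m c =>
      refine ⟨m, MvPolynomial.C c * MvPolynomial.X 0 ^ n * MvPolynomial.X 1 ^ m, ?_⟩
      rw [map_mul, map_mul, map_pow, map_pow, radial_X_zero, radial_X_one, radial_C,
        ← C_mul_X_pow_eq_monomial, ← C_mul_X_pow_eq_monomial, C_mul, C_pow]
      ring

theorem aeval_radial {S : Type*} [CommSemiring S] [Algebra R S] [Algebra R[X] S]
    [IsScalarTower R R[X] S] {u v : S} (h : algebraMap R[X] S X * u = v)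
    (p : MvPolynomial (Fin 2) R) : aeval u (radial R p) = MvPolynomial.aeval ![u, v] p := by
  induction p using MvPolynomial.induction_on with
  | C a =>
    rw [radial_C, aeval_C, MvPolynomial.aeval_C, ← algebraMap_eq, ← IsScalarTower.algebraMap_apply]
  | add p q hp hq => rw [map_add, map_add, hp, hq, map_add]
  | mul_X p i hp =>
    rw [map_mul, map_mul, hp, map_mul]
    congr 1
    fin_cases i
    · simp [radial_X_zero]
    · simp [radial_X_one, h]

end Radial

section Slope

variable {k F K : Type*} [Field k] [Field F] [Field K] [Algebra k K] [Algebra k[X] K]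
  [IsScalarTower k k[X] K] {u v : K} {f : MvPolynomial (Fin 2) k}

/-- The witness is the strict transform of the curve `f = 0`, whose points over a slope are the
points other than the origin on the line of that slope. -/
theorem exists_aeval_eq_zero_of_aeval_eq_zero (hu : u ≠ 0) (hv : algebraMap k[X] K X * u = v)
    (hf0 : f ≠ 0) (hf : MvPolynomial.aeval ![u, v] f = 0) :
    ∃ q : k[X][X], q ≠ 0 ∧ aeval u q = 0 ∧ q.natDegree + orderAtOrigin f = f.totalDegree := by
  have hr0 : radial k f ≠ 0 := radial_eq_zero_iff.not.mpr hf0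
  obtain ⟨q, hq⟩ : X ^ orderAtOrigin f ∣ radial k f := by
    rw [X_pow_dvd_iff, ← natTrailingDegree_radial hf0]
    exact fun d hd => coeff_eq_zero_of_lt_natTrailingDegree hd
  have hq0 : q ≠ 0 := right_ne_zero_of_mul (hq ▸ hr0)
  refine ⟨q, hq0, ?_, ?_⟩
  · rw [← aeval_radial hv, hq, map_mul, map_pow, aeval_X] at hf
    exact (mul_eq_zero.mp hf).resolve_left (pow_ne_zero _ hu)
  · rw [← natDegree_radial, hq, natDegree_mul (pow_ne_zero _ X_ne_zero) hq0, natDegree_X_pow,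
      add_comm]

theorem totalDegree_le_natDegree_add_orderAtOrigin (hv : algebraMap k[X] K X * u = v)
    (hf0 : f ≠ 0) (hf : RingHom.ker (MvPolynomial.aeval (R := k) ![u, v]) ≤ Ideal.span {f})
    {q : k[X][X]} (hq0 : q ≠ 0) (hq : aeval u q = 0) :
    f.totalDegree ≤ q.natDegree + orderAtOrigin f := by
  obtain ⟨N, p, hp⟩ := exists_radial_eq_X_pow_mul q
  obtain ⟨r, rfl⟩ : f ∣ p := by
    refine Ideal.mem_span_singleton.mp (hf ?_)
    rw [RingHom.mem_ker, ← aeval_radial hv, hp, map_mul, hq, mul_zero]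
  have hX : (X ^ N : k[X][X]) ≠ 0 := pow_ne_zero _ X_ne_zero
  have hf0' : radial k f ≠ 0 := radial_eq_zero_iff.not.mpr hf0
  rw [map_mul] at hp
  have hr0 : radial k r ≠ 0 := by
    refine right_ne_zero_of_mul (a := radial k f) ?_
    rw [hp]
    exact mul_ne_zero hX hq0
  have hdeg := congrArg natDegree hp
  have htrail := congrArg natTrailingDegree hp
  rw [natDegree_mul hf0' hr0, natDegree_mul hX hq0, natDegree_X_pow, natDegree_radial] at hdeg
  rw [natTrailingDegree_mul hf0' hr0, natTrailingDegree_mul hX hq0, natTrailingDegree_X_pow,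
    natTrailingDegree_radial hf0] at htrail
  have := natTrailingDegree_le_natDegree (radial k r)
  omega

theorem isIntegral_and_natDegree_minpoly_add_orderAtOrigin [Algebra k[X] F] [IsFractionRing k[X] F]
    [Algebra F K] [IsScalarTower k[X] F K] (hu : u ≠ 0) (hv : algebraMap k[X] K X * u = v)
    (hf0 : f ≠ 0) (hf : RingHom.ker (MvPolynomial.aeval (R := k) ![u, v]) = Ideal.span {f}) :
    IsIntegral F u ∧ (minpoly F u).natDegree + orderAtOrigin f = f.totalDegree := by
  have hinj := IsFractionRing.injective k[X] F
  obtain ⟨q, hq0, hqu, hqdeg⟩ := exists_aeval_eq_zero_of_aeval_eq_zero hu hv hf0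
    (RingHom.mem_ker.mp (hf.ge (Ideal.mem_span_singleton_self f)))
  have hqF0 : q.map (algebraMap k[X] F) ≠ 0 := (Polynomial.map_ne_zero_iff hinj).mpr hq0
  have hqFu : aeval u (q.map (algebraMap k[X] F)) = 0 := by rwa [aeval_map_algebraMap]
  have hu_int : IsIntegral F u := IsAlgebraic.isIntegral ⟨_, hqF0, hqFu⟩
  refine ⟨hu_int, le_antisymm ?_ ?_⟩
  · have := natDegree_le_of_dvd (minpoly.dvd F u hqFu) hqF0
    rw [natDegree_map_eq_of_injective hinj] at this
    omega
  · let μ := IsLocalization.integerNormalization (nonZeroDivisors k[X]) (minpoly F u)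
    have hμdeg : μ.natDegree ≤ (minpoly F u).natDegree :=
      natDegree_le_natDegree
        (Finset.sup_mono (IsLocalization.integerNormalization_support _ (minpoly F u)))
    have hμ0 : μ ≠ 0 :=
      (IsLocalization.integerNormalization_eq_zero_iff le_rfl _).not.mpr (minpoly.ne_zero hu_int)
    have hμu : aeval u μ = 0 :=
      IsLocalization.integerNormalization_aeval_eq_zero _ _ (minpoly.aeval F u)
    have := totalDegree_le_natDegree_add_orderAtOrigin hv hf0 hf.le hμ0 hμu
    omega

end Slope

section AdjoinSimple

variable {k K : Type*} [Field k] [Field K] [Algebra k K]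

/-- The algebra structure of `k(g)` over `k[X]` in which `X` acts by `g`. -/
abbrev polynomialAlgebraAdjoin (g : K) : Algebra k[X] (IntermediateField.adjoin k {g}) :=
  (aeval (IntermediateField.AdjoinSimple.gen k g) :
    k[X] →ₐ[k] IntermediateField.adjoin k {g}).toRingHom.toAlgebra

/-- The algebra structure of `K` over `k[X]` in which `X` acts by `g`. -/
abbrev polynomialAlgebra (g : K) : Algebra k[X] K :=
  (aeval g : k[X] →ₐ[k] K).toRingHom.toAlgebra

theorem isFractionRing_polynomialAlgebraAdjoin {g : K} (hg : Transcendental k g) :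
    letI := polynomialAlgebraAdjoin (k := k) g
    IsFractionRing k[X] (IntermediateField.adjoin k {g}) := by
  let := polynomialAlgebraAdjoin (k := k) g
  have := (faithfulSMul_iff_algebraMap_injective k[X] (IntermediateField.adjoin k {g})).mpr
    (transcendental_iff_injective.mp fun h => hg (h.algebraMap (A := K)))
  refine IsFractionRing.of_field k[X] _ fun z => ?_
  obtain ⟨r, s, h⟩ := (IntermediateField.mem_adjoin_simple_iff k _).mp z.2
  refine ⟨r, s, Subtype.ext ?_⟩
  rw [h]
  simp [RingHom.algebraMap_toAlgebra]

theorem isScalarTower_polynomialAlgebra (g : K) :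
    letI := polynomialAlgebra (k := k) g
    IsScalarTower k k[X] K := by
  let := polynomialAlgebra (k := k) g
  exact .of_algebraMap_eq fun c => (aeval_C g c).symm

theorem isScalarTower_polynomialAlgebraAdjoin (g : K) :
    letI := polynomialAlgebra (k := k) g
    letI := polynomialAlgebraAdjoin (k := k) g
    IsScalarTower k[X] (IntermediateField.adjoin k {g}) K := by
  let := polynomialAlgebra (k := k) g
  let := polynomialAlgebraAdjoin (k := k) g
  refine .of_algebraMap_eq' ?_
  ext c <;> simp [RingHom.algebraMap_toAlgebra]

theorem adjoin_adjoin_div_eq_top {u v : K} (hu : u ≠ 0)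
    (hK : IntermediateField.adjoin k {u, v} = ⊤) :
    IntermediateField.adjoin (IntermediateField.adjoin k {v / u}) {u} = ⊤ := by
  rw [← IntermediateField.restrictScalars_eq_top_iff (K := k),
    IntermediateField.adjoin_adjoin_left, eq_top_iff, ← hK, IntermediateField.adjoin_le_iff]
  have hu' : u ∈ IntermediateField.adjoin k ({v / u} ∪ {u}) :=
    IntermediateField.subset_adjoin k _ (by simp)
  have hv' : v ∈ IntermediateField.adjoin k ({v / u} ∪ {u}) := by
    have := mul_mem (IntermediateField.subset_adjoin k ({v / u} ∪ {u}) (Or.inl rfl)) hu'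
    rwa [div_mul_cancel₀ v hu] at this
  rintro z (rfl | rfl)
  exacts [hu', hv']

/-- The degree of the projection of a plane curve from the origin is the degree of the curve minus
its multiplicity there. -/
theorem finrank_adjoin_slope_add_orderAtOrigin {u v : K} (hu : u ≠ 0)
    (hg : Transcendental k (v / u)) (hK : IntermediateField.adjoin k {u, v} = ⊤)
    {f : MvPolynomial (Fin 2) k} (hf0 : f ≠ 0)
    (hf : RingHom.ker (MvPolynomial.aeval (R := k) ![u, v]) = Ideal.span {f}) :
    Module.finrank (IntermediateField.adjoin k {v / u}) K + orderAtOrigin f = f.totalDegree := by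
  let := polynomialAlgebra (k := k) (v / u)
  let := polynomialAlgebraAdjoin (k := k) (v / u)
  have := isScalarTower_polynomialAlgebra (k := k) (v / u)
  have := isScalarTower_polynomialAlgebraAdjoin (k := k) (v / u)
  have := isFractionRing_polynomialAlgebraAdjoin hg
  have hv : algebraMap k[X] K X * u = v := by
    rw [show algebraMap k[X] K X = v / u from aeval_X _, div_mul_cancel₀ _ hu]
  obtain ⟨hu_int, hdeg⟩ := isIntegral_and_natDegree_minpoly_add_orderAtOrigin
    (F := IntermediateField.adjoin k {v / u}) hu hv hf0 hf
  rw [← hdeg, ← IntermediateField.adjoin.finrank hu_int, adjoin_adjoin_div_eq_top hu hK,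
    IntermediateField.finrank_top']

end AdjoinSimple

section Translate

variable {σ R : Type*} [CommRing R]

theorem aeval_X_add_C_comp (a a' : σ → R) :
    (MvPolynomial.aeval fun i => MvPolynomial.X i + MvPolynomial.C (a i)).comp
      (MvPolynomial.aeval fun i => MvPolynomial.X i + MvPolynomial.C (a' i)) =
    MvPolynomial.aeval (R := R) fun i => MvPolynomial.X i + MvPolynomial.C (a i + a' i) := by
  ext1 i
  simp [add_assoc]

/-- The translation `f(X) ↦ f(X + a)`, which moves the point `a` to the origin. -/
def translate (a : σ → R) : MvPolynomial σ R ≃ₐ[R] MvPolynomial σ R :=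
  .ofAlgHom (MvPolynomial.aeval fun i => MvPolynomial.X i + MvPolynomial.C (a i))
    (MvPolynomial.aeval fun i => MvPolynomial.X i + MvPolynomial.C ((-a) i))
    ((aeval_X_add_C_comp a (-a)).trans (by ext1; simp))
    ((aeval_X_add_C_comp (-a) a).trans (by ext1; simp))

theorem translate_apply (a : σ → R) (p : MvPolynomial σ R) : translate a p =
    MvPolynomial.aeval (fun i => MvPolynomial.X i + MvPolynomial.C (a i)) p := rfl

theorem aeval_translate {S : Type*} [CommRing S] [Algebra R S] (a : σ → R) (w : σ → S)
    (p : MvPolynomial σ R) : MvPolynomial.aeval w (translate a p) =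
      MvPolynomial.aeval (fun i => w i + algebraMap R S (a i)) p := by
  rw [translate_apply, ← AlgHom.comp_apply, MvPolynomial.comp_aeval]
  simp

theorem translate_neg_translate (a : σ → R) (p : MvPolynomial σ R) :
    translate (-a) (translate a p) = p := by
  rw [translate_apply, aeval_translate]
  simp

theorem constantCoeff_translate (a : σ → R) (p : MvPolynomial σ R) :
    MvPolynomial.constantCoeff (translate a p) = MvPolynomial.eval a p := by
  simpa [MvPolynomial.constantCoeff_eq, MvPolynomial.aeval_eq_eval, MvPolynomial.eval_zero'] using
    aeval_translate a (0 : σ → R) p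

theorem totalDegree_X_add_C_le (i : σ) (c : R) :
    (MvPolynomial.X i + MvPolynomial.C c).totalDegree ≤ 1 := by
  refine (MvPolynomial.totalDegree_add _ _).trans (max_le ?_ ?_)
  · exact (MvPolynomial.totalDegree_monomial_le _ 1).trans_eq (Finsupp.sum_single_index rfl)
  · rw [MvPolynomial.totalDegree_C]
    exact zero_le_one

theorem totalDegree_translate_le (a : σ → R) (p : MvPolynomial σ R) :
    (translate a p).totalDegree ≤ p.totalDegree := by
  rw [translate_apply, MvPolynomial.aeval_def, MvPolynomial.eval₂_eq]
  refine MvPolynomial.totalDegree_finsetSum_le fun e he => ?_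
  refine (MvPolynomial.totalDegree_mul _ _).trans ?_
  rw [MvPolynomial.algebraMap_eq, MvPolynomial.totalDegree_C, zero_add]
  refine (MvPolynomial.totalDegree_finsetProd _ _).trans
    (le_trans ?_ (MvPolynomial.le_totalDegree he))
  refine Finset.sum_le_sum fun i _ => (MvPolynomial.totalDegree_pow _ _).trans ?_
  exact mul_le_of_le_one_right (Nat.zero_le _) (totalDegree_X_add_C_le i (a i))

theorem totalDegree_translate (a : σ → R) (p : MvPolynomial σ R) :
    (translate a p).totalDegree = p.totalDegree := by
  refine (totalDegree_translate_le a p).antisymm ?_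
  have := totalDegree_translate_le (-a) (translate a p)
  rwa [translate_neg_translate] at this

theorem ker_aeval_sub_eq_map_translate {S : Type*} [CommRing S] [Algebra R S] (a : σ → R)
    (w : σ → S) : RingHom.ker (MvPolynomial.aeval (R := R) fun i => w i - algebraMap R S (a i)) =
      (RingHom.ker (MvPolynomial.aeval (R := R) w)).map (translate a) := by
  ext p
  obtain ⟨q, rfl⟩ := (translate a).surjective p
  rw [RingHom.mem_ker, aeval_translate, Ideal.mem_map_of_equiv (translate a)]
  simp only [sub_add_cancel, RingHom.mem_ker, (translate a).injective.eq_iff, exists_eq_right]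

theorem adjoin_range_sub_algebraMap {k K : Type*} [Field k] [Field K] [Algebra k K] (a : σ → k)
    (w : σ → K) : IntermediateField.adjoin k (Set.range fun i => w i - algebraMap k K (a i)) =
      IntermediateField.adjoin k (Set.range w) := by
  apply le_antisymm <;> rw [IntermediateField.adjoin_le_iff] <;> rintro _ ⟨i, rfl⟩
  · exact sub_mem (IntermediateField.subset_adjoin k _ ⟨i, rfl⟩)
      (IntermediateField.algebraMap_mem _ _)
  · rw [← sub_add_cancel (w i) (algebraMap k K (a i))]
    exact add_mem (IntermediateField.subset_adjoin k _ ⟨i, rfl⟩)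
      (IntermediateField.algebraMap_mem _ _)

end Translate

section Equation

variable {k K : Type*} [Field k] [Field K] [Algebra k K]

/-- The degree of the projection of a plane curve from a point off the curve is the degree of the
curve. -/
theorem finrank_adjoin_slope_of_eval_ne_zero {w : Fin 2 → K} {a : Fin 2 → k}
    (hw : w 0 - algebraMap k K (a 0) ≠ 0)
    (hg : Transcendental k ((w 1 - algebraMap k K (a 1)) / (w 0 - algebraMap k K (a 0))))
    (hK : IntermediateField.adjoin k (Set.range w) = ⊤) {f : MvPolynomial (Fin 2) k}
    (hf : RingHom.ker (MvPolynomial.aeval (R := k) w) = Ideal.span {f})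
    (ha : MvPolynomial.eval a f ≠ 0) :
    Module.finrank (IntermediateField.adjoin k
      {(w 1 - algebraMap k K (a 1)) / (w 0 - algebraMap k K (a 0))}) K = f.totalDegree := by
  have hvec : ![w 0 - algebraMap k K (a 0), w 1 - algebraMap k K (a 1)] =
      fun i => w i - algebraMap k K (a i) :=
    (FinVec.etaExpand_eq fun i => w i - algebraMap k K (a i))
  have hc : MvPolynomial.constantCoeff (translate a f) ≠ 0 := by rwa [constantCoeff_translate]
  have hdeg := finrank_adjoin_slope_add_orderAtOrigin hw hg
    (by rw [← Matrix.range_cons_cons_empty, hvec, adjoin_range_sub_algebraMap, hK])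
    (fun h => hc (by rw [h, map_zero])) (f := translate a f)
    (by rw [hvec, ker_aeval_sub_eq_map_translate, hf, Ideal.map_span, Set.image_singleton])
  rwa [orderAtOrigin_eq_zero_of_constantCoeff_ne_zero hc, add_zero, totalDegree_translate] at hdeg

theorem exists_eval_ne_zero {σ : Type*} [Infinite k] {f : MvPolynomial σ k} (hf : f ≠ 0) :
    ∃ a : σ → k, MvPolynomial.eval a f ≠ 0 := by
  by_contra! h
  exact hf (MvPolynomial.funext fun a => by rw [h a, map_zero])

theorem not_isMaximal_ker_aeval {σ : Type*} [Finite σ] {w : σ → K} {i : σ}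
    (hw : Transcendental k (w i)) :
    ¬ (RingHom.ker (MvPolynomial.aeval (R := k) w)).IsMaximal := by
  set P := RingHom.ker (MvPolynomial.aeval (R := k) w)
  intro hmax
  let := Ideal.Quotient.field P
  have : Algebra.FiniteType k (MvPolynomial σ k ⧸ P) :=
    .of_surjective (Ideal.Quotient.mkₐ k P) (Ideal.Quotient.mkₐ_surjective k P)
  have := finite_of_finite_type_of_isJacobsonRing k (MvPolynomial σ k ⧸ P)
  have h : IsIntegral k (MvPolynomial.aeval w (MvPolynomial.X i)) :=
    (Algebra.IsIntegral.isIntegral (R := k) (Ideal.Quotient.mk P (MvPolynomial.X i))).map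
      (Ideal.Quotient.liftₐ P (MvPolynomial.aeval w) fun _ ha => ha)
  rw [MvPolynomial.aeval_X] at h
  exact hw h.isAlgebraic

theorem height_le_one_of_not_isMaximal {P : Ideal (MvPolynomial (Fin 2) k)} [hP : P.IsPrime]
    (hmax : ¬ P.IsMaximal) : P.height ≤ 1 := by
  obtain ⟨M, hM, hPM⟩ := P.exists_le_maximal hP.ne_top
  have hM2 : (M.height : WithBot ℕ∞) ≤ 2 := by
    have h := Ideal.height_le_ringKrullDim_of_isPrime (I := M)
    rw [MvPolynomial.ringKrullDim_of_isNoetherianRing, ringKrullDim_eq_zero_of_field] at h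
    simpa using h
  refine (ENat.add_le_add_iff_right ENat.one_ne_top).mp ?_
  calc P.height + 1 ≤ M.height :=
        Ideal.height_add_one_le_of_lt_of_isPrime (hPM.lt_of_ne fun h => hmax (h ▸ hM))
    _ ≤ 1 + 1 := by
        rw [one_add_one_eq_two]
        exact WithBot.coe_le_coe.mp hM2

theorem exists_ker_aeval_eq_span {w : Fin 2 → K} (hw : ¬ AlgebraicIndependent k w)
    {i : Fin 2} (hi : Transcendental k (w i)) :
    ∃ f : MvPolynomial (Fin 2) k, f ≠ 0 ∧
      RingHom.ker (MvPolynomial.aeval (R := k) w) = Ideal.span {f} := by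
  have hbot : RingHom.ker (MvPolynomial.aeval (R := k) w) ≠ ⊥ := fun h =>
    hw ((RingHom.injective_iff_ker_eq_bot _).mpr h)
  have hprime : (RingHom.ker (MvPolynomial.aeval (R := k) w)).IsPrime := RingHom.ker_isPrime _
  have hheight : (RingHom.ker (MvPolynomial.aeval (R := k) w)).height = 1 :=
    (height_le_one_of_not_isMaximal (not_isMaximal_ker_aeval hi)).antisymm
      (Order.one_le_iff_ne_zero.mpr fun h => hbot (Ideal.height_eq_zero_iff_eq_bot.mp h))
  obtain ⟨f, hf⟩ := UniqueFactorizationMonoid.isPrincipal_of_height_eq_one hheight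
  refine ⟨f, ?_, hf⟩
  rintro rfl
  exact hbot (by simpa using hf)

end Equation

end PlaneCurvePolynomials

section PlacesOfFunctionFields

open Polynomial IsDedekindDomain WithZero

section ValuationSubring

variable {K : Type*} [Field K] {A : ValuationSubring K}

/-- Such a valuation ring is centred at a maximal ideal of `R`, and it contains, hence equals, the
localization of `R` there. -/
theorem exists_eq_valuationSubring_of_algebraMap_mem {R : Type*} [CommRing R] [IsDedekindDomain R]
    [Algebra R K] [IsFractionRing R K] (hA : A ≠ ⊤) (hR : ∀ r : R, algebraMap R K r ∈ A) :
    ∃ v : HeightOneSpectrum R, A = (v.valuation K).valuationSubring := by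
  let ψ : R →+* A := (algebraMap R K).codRestrict A.toSubring hR
  let P := (IsLocalRing.maximalIdeal A).comap ψ
  have hdiv : ∀ (r : R) {s : R}, s ∉ P → algebraMap R K r * (algebraMap R K s)⁻¹ ∈ A := by
    intro r s hs
    obtain ⟨b, hb⟩ := (not_not.mp fun h => hs ((IsLocalRing.mem_maximalIdeal _).mpr h) :
      IsUnit (ψ s)).exists_right_inv
    have hb' : algebraMap R K s * b = 1 := congrArg Subtype.val hb
    rw [← eq_inv_of_mul_eq_one_right hb']
    exact mul_mem (hR r) b.2
  have hP0 : P ≠ ⊥ := by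
    refine fun hP => hA (top_unique fun z _ => ?_)
    obtain ⟨r, s, hs, rfl⟩ := IsFractionRing.div_surjective (A := R) z
    rw [div_eq_mul_inv]
    exact hdiv r fun h => nonZeroDivisors.ne_zero hs (by rwa [hP, Ideal.mem_bot] at h)
  let v : HeightOneSpectrum R := ⟨P, Ideal.comap_isPrime _ _, hP0⟩
  refine ⟨v, ?_⟩
  rw [← HeightOneSpectrum.valuationSubringAtPrime_eq_valuationSubring]
  refine (ValuationSubring.eq_of_le_of_ne_top _ ?_ hA).symm
  rintro _ ⟨a, s, hs, rfl⟩
  exact hdiv a hs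

theorem algebraMap_mem_of_isIntegral {S R : Type*} [CommRing S] [CommRing R] [Algebra S R]
    [Algebra.IsIntegral S R] [Algebra S K] [Algebra R K] [IsScalarTower S R K]
    (hS : ∀ s : S, algebraMap S K s ∈ A) (r : R) : algebraMap R K r ∈ A := by
  let : Algebra S A := ((algebraMap S K).codRestrict A.toSubring hS).toAlgebra
  have : IsScalarTower S A K := .of_algebraMap_eq fun _ => rfl
  have hr_int : IsIntegral S (algebraMap R K r) := (Algebra.IsIntegral.isIntegral r).algebraMap
  obtain ⟨y, hy⟩ := IsIntegrallyClosed.algebraMap_eq_of_integral (hr_int.tower_top (A := A))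
  rw [← hy]
  exact y.2

end ValuationSubring

/-- The valuation rings `A i` are all the nontrivial valuation rings of `K` over `k`, each of them
once, and each of them is discrete with normalized valuation `ord i`. -/
structure IsPlaceSystem (k : Type*) {K ι : Type*} [Field k] [Field K] [Algebra k K]
    (A : ι → ValuationSubring K) (ord : ι → K → ℤ) : Prop where
  ord_mul : ∀ i {f g : K}, f ≠ 0 → g ≠ 0 → ord i (f * g) = ord i f + ord i g
  ord_nonneg_iff : ∀ i {f : K}, f ≠ 0 → (0 ≤ ord i f ↔ f ∈ A i)
  exists_ord_eq_one : ∀ i, ∃ t : K, t ≠ 0 ∧ ord i t = 1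
  algebraMap_mem : ∀ i (c : k), algebraMap k K c ∈ A i
  injective : Function.Injective A
  surjective : ∀ B : ValuationSubring K, (∀ c : k, algebraMap k K c ∈ B) → B ≠ ⊤ → ∃ i, A i = B

namespace IsPlaceSystem

variable {k K ι : Type*} [Field k] [Field K] [Algebra k K]
  {A : ι → ValuationSubring K} {ord : ι → K → ℤ}

theorem ord_one (H : IsPlaceSystem k A ord) (i : ι) : ord i 1 = 0 := by
  have := H.ord_mul i (one_ne_zero (α := K)) one_ne_zero
  rw [mul_one] at this
  omega

theorem ord_inv (H : IsPlaceSystem k A ord) (i : ι) {f : K} (hf : f ≠ 0) :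
    ord i f⁻¹ = - ord i f := by
  have := H.ord_mul i hf (inv_ne_zero hf)
  rw [mul_inv_cancel₀ hf, H.ord_one] at this
  omega

theorem ord_div (H : IsPlaceSystem k A ord) (i : ι) {f g : K} (hf : f ≠ 0) (hg : g ≠ 0) :
    ord i (f / g) = ord i f - ord i g := by
  rw [div_eq_mul_inv, H.ord_mul i hf (inv_ne_zero hg), H.ord_inv i hg, sub_eq_add_neg]

theorem ord_pow (H : IsPlaceSystem k A ord) (i : ι) {f : K} (hf : f ≠ 0) (n : ℕ) :
    ord i (f ^ n) = n * ord i f := by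
  induction n with
  | zero => simp [H.ord_one]
  | succ n ih =>
    rw [pow_succ, H.ord_mul i (pow_ne_zero _ hf) hf, ih]
    push_cast
    ring

theorem ord_zpow (H : IsPlaceSystem k A ord) (i : ι) {f : K} (hf : f ≠ 0) (n : ℤ) :
    ord i (f ^ n) = n * ord i f := by
  obtain ⟨m, rfl | rfl⟩ := n.eq_nat_or_neg
  · rw [zpow_natCast, H.ord_pow i hf]
  · rw [zpow_neg, zpow_natCast, H.ord_inv i (pow_ne_zero _ hf), H.ord_pow i hf]
    ring

theorem ord_eq_zero_of_mem (H : IsPlaceSystem k A ord) (i : ι) {f : K} (hf : f ≠ 0)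
    (h : f ∈ A i) (h' : f⁻¹ ∈ A i) : ord i f = 0 := by
  have h1 := (H.ord_nonneg_iff i hf).mpr h
  have h2 := (H.ord_nonneg_iff i (inv_ne_zero hf)).mpr h'
  rw [H.ord_inv i hf] at h2
  omega

theorem ord_algebraMap (H : IsPlaceSystem k A ord) (i : ι) {c : k} (hc : c ≠ 0) :
    ord i (algebraMap k K c) = 0 := by
  refine H.ord_eq_zero_of_mem i ?_ (H.algebraMap_mem i c) ?_
  · simpa using hc
  · rw [← map_inv₀]
    exact H.algebraMap_mem i _

theorem ne_top (H : IsPlaceSystem k A ord) (i : ι) : A i ≠ ⊤ := by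
  intro h
  obtain ⟨t, ht, ht1⟩ := H.exists_ord_eq_one i
  have := (H.ord_nonneg_iff i (inv_ne_zero ht)).mpr (h ▸ ValuationSubring.mem_top _)
  rw [H.ord_inv i ht, ht1] at this
  omega

section Dedekind

variable {R : Type*} [CommRing R] [IsDedekindDomain R] [Algebra R K] [IsFractionRing R K]
  {v : HeightOneSpectrum R} {i : ι}

theorem ord_eq_zero_of_valuation_eq_one (H : IsPlaceSystem k A ord)
    (hi : A i = (v.valuation K).valuationSubring) {f : K} (hf : v.valuation K f = 1) :
    ord i f = 0 := by
  refine H.ord_eq_zero_of_mem i ?_ ?_ ?_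
  · exact (Valuation.ne_zero_iff _).mp (hf.trans_ne one_ne_zero)
  · rw [hi, Valuation.mem_valuationSubring_iff, hf]
  · rw [hi, Valuation.mem_valuationSubring_iff, map_inv₀, hf, inv_one]

theorem ord_eq_mul_ord_of_valuation_eq_exp (H : IsPlaceSystem k A ord)
    (hi : A i = (v.valuation K).valuationSubring) {π f : K} {n : ℤ}
    (hπ : v.valuation K π = exp (-1 : ℤ)) (hf : v.valuation K f = exp (-n)) :
    ord i f = n * ord i π := by
  have hπ0 : π ≠ 0 := (Valuation.ne_zero_iff _).mp (hπ.trans_ne exp_ne_zero)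
  have hf0 : f ≠ 0 := (Valuation.ne_zero_iff _).mp (hf.trans_ne exp_ne_zero)
  have hone : v.valuation K (f / π ^ n) = 1 := by
    rw [map_div₀, map_zpow₀, hπ, hf, ← exp_zsmul, smul_neg, zsmul_one, Int.cast_id,
      div_self exp_ne_zero]
  have hord := H.ord_eq_zero_of_valuation_eq_one hi hone
  rwa [H.ord_div i hf0 (zpow_ne_zero _ hπ0), H.ord_zpow i hπ0, sub_eq_zero] at hord

theorem ord_eq_one_of_valuation_eq_exp (H : IsPlaceSystem k A ord)
    (hi : A i = (v.valuation K).valuationSubring) {π : K}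
    (hπ : v.valuation K π = exp (-1 : ℤ)) : ord i π = 1 := by
  obtain ⟨t, ht, ht1⟩ := H.exists_ord_eq_one i
  have hvt : v.valuation K t = exp (-(-log (v.valuation K t))) := by
    rw [neg_neg, exp_log ((Valuation.ne_zero_iff _).mpr ht)]
  have hdvd := H.ord_eq_mul_ord_of_valuation_eq_exp hi hπ hvt
  have hπ0 : π ≠ 0 := (Valuation.ne_zero_iff _).mp (hπ.trans_ne exp_ne_zero)
  have hnonneg : 0 ≤ ord i π := by
    rw [H.ord_nonneg_iff i hπ0, hi, Valuation.mem_valuationSubring_iff, hπ, ← exp_zero, exp_le_exp]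
    exact neg_one_lt_zero.le
  exact Int.eq_one_of_dvd_one hnonneg (Dvd.intro_left _ (hdvd.symm.trans ht1))

theorem valuation_eq_exp_neg_ord (H : IsPlaceSystem k A ord)
    (hi : A i = (v.valuation K).valuationSubring) {f : K} (hf : f ≠ 0) :
    v.valuation K f = exp (-ord i f) := by
  obtain ⟨π, hπ⟩ := v.valuation_exists_uniformizer K
  have hvf : v.valuation K f = exp (-(-log (v.valuation K f))) := by
    rw [neg_neg, exp_log ((Valuation.ne_zero_iff _).mpr hf)]
  rw [H.ord_eq_mul_ord_of_valuation_eq_exp hi hπ hvf, H.ord_eq_one_of_valuation_eq_exp hi hπ,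
    mul_one, ← hvf]

variable [Algebra k R] [IsScalarTower k R K]

theorem exists_eq_valuationSubring (H : IsPlaceSystem k A ord) (v : HeightOneSpectrum R) :
    ∃ i, A i = (v.valuation K).valuationSubring := by
  refine H.surjective _ (fun c => ?_) ?_
  · rw [IsScalarTower.algebraMap_apply k R K, Valuation.mem_valuationSubring_iff]
    exact v.valuation_le_one _
  · rw [ne_eq, Valuation.valuationSubring_eq_top_iff, not_not]
    infer_instance

/-- The place whose valuation ring is the localization at the maximal ideal `v` of a Dedekind domain
with field of fractions `K`. -/
def place (H : IsPlaceSystem k A ord) (v : HeightOneSpectrum R) : ι :=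
  (H.exists_eq_valuationSubring v).choose

theorem apply_place (H : IsPlaceSystem k A ord) (v : HeightOneSpectrum R) :
    A (H.place v) = (v.valuation K).valuationSubring :=
  (H.exists_eq_valuationSubring v).choose_spec

theorem place_injective (H : IsPlaceSystem k A ord) :
    Function.Injective (H.place : HeightOneSpectrum R → ι) := by
  intro v w hvw
  refine HeightOneSpectrum.eq_of_valuation_isEquiv_valuation (K := K)
    ((Valuation.isEquiv_iff_valuationSubring _ _).mpr ?_)
  rw [← H.apply_place, ← H.apply_place, hvw]

theorem ord_place (H : IsPlaceSystem k A ord) (v : HeightOneSpectrum R) {r : R} (hr : r ≠ 0) :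
    ord (H.place v) (algebraMap R K r) = multiplicity v.asIdeal (Ideal.span {r}) := by
  have hr0 : algebraMap R K r ≠ 0 := by
    rwa [ne_eq, FaithfulSMul.algebraMap_eq_zero_iff]
  have h := H.valuation_eq_exp_neg_ord (H.apply_place v) hr0
  rw [HeightOneSpectrum.valuation_of_algebraMap,
    HeightOneSpectrum.intValuation_eq_exp_neg_multiplicity _ hr, exp_inj, neg_inj] at h
  exact h.symm

theorem ord_place_pos_iff (H : IsPlaceSystem k A ord) (v : HeightOneSpectrum R) {r : R}
    (hr : r ≠ 0) : 0 < ord (H.place v) (algebraMap R K r) ↔ r ∈ v.asIdeal := by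
  have hr0 : algebraMap R K r ≠ 0 := by
    rwa [ne_eq, FaithfulSMul.algebraMap_eq_zero_iff]
  rw [← HeightOneSpectrum.valuation_lt_one_iff_mem (K := K),
    H.valuation_eq_exp_neg_ord (H.apply_place v) hr0, ← exp_zero, exp_lt_exp, neg_lt_zero]

theorem exists_place_eq (H : IsPlaceSystem k A ord) (hR : ∀ r : R, algebraMap R K r ∈ A i) :
    ∃ v : HeightOneSpectrum R, H.place v = i := by
  obtain ⟨v, hv⟩ := exists_eq_valuationSubring_of_algebraMap_mem (H.ne_top i) hR
  exact ⟨v, H.injective ((H.apply_place v).trans hv.symm)⟩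

end Dedekind

end IsPlaceSystem

section AlgClosed

variable {k : Type*} [Field k] [IsAlgClosed k]

theorem exists_algebraMap_eq_of_isAlgebraic {K : Type*} [Field K] [Algebra k K] {x : K}
    (hx : IsAlgebraic k x) : ∃ c : k, algebraMap k K c = x :=
  minpoly.mem_range_of_degree_eq_one k x
    (IsAlgClosed.degree_eq_one_of_irreducible k (minpoly.irreducible hx.isIntegral))

theorem finrank_eq_one_of_isAlgClosed (L : Type*) [Field L] [Algebra k L]
    [Algebra.IsIntegral k L] : Module.finrank k L = 1 := by
  rw [← (LinearEquiv.ofBijective (Algebra.linearMap k L)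
    IsAlgClosed.algebraMap_bijective_of_isIntegral).finrank_eq, Module.finrank_self]

theorem inertiaDeg_eq_one_of_liesOver_span_X {B : Type*} [CommRing B] [IsDomain B] [Algebra k[X] B]
    [Algebra.IsIntegral k[X] B] (q : Ideal B) [q.IsPrime] [q.LiesOver (Ideal.span {(X : k[X])})] :
    q.inertiaDeg k[X] = 1 := by
  have : (Ideal.span {(X : k[X])}).IsMaximal :=
    PrincipalIdealRing.isMaximal_of_irreducible irreducible_X
  have : q.IsMaximal := Ideal.IsMaximal.of_liesOver_isMaximal q (Ideal.span {(X : k[X])})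
  rw [Ideal.inertiaDeg_eq_of_isMaximal (Ideal.span {(X : k[X])}) q]
  let := Ideal.Quotient.field (Ideal.span {(X : k[X])})
  let := Ideal.Quotient.field q
  have : IsAlgClosed (k[X] ⧸ Ideal.span {(X : k[X])}) := IsAlgClosed.of_ringEquiv k _
    ((Ideal.quotEquivOfEq (by rw [C_0, sub_zero])).trans
      (quotientSpanXSubCAlgEquiv (0 : k)).toRingEquiv).symm
  exact finrank_eq_one_of_isAlgClosed _

end AlgClosed

section FinitePolynomial

variable {k B : Type*} [Field k] [CommRing B] [IsDedekindDomain B] [Algebra k[X] B]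

theorem mem_primesOver_span_X_iff (q : Ideal B) [hq : q.IsPrime] :
    q ∈ (Ideal.span {(X : k[X])}).primesOver B ↔ algebraMap k[X] B X ∈ q := by
  have : (Ideal.span {(X : k[X])}).IsMaximal :=
    PrincipalIdealRing.isMaximal_of_irreducible irreducible_X
  rw [Ideal.primesOver, Set.mem_ofPred_eq, and_iff_right hq, Ideal.liesOver_iff_dvd_map hq.ne_top,
    Ideal.dvd_iff_le, Ideal.map_span, Set.image_singleton, Ideal.span_singleton_le_iff_mem]

variable (k B) in
theorem bijOn_asIdeal_primesOver_span_X [FaithfulSMul k[X] B] :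
    Set.BijOn HeightOneSpectrum.asIdeal {v : HeightOneSpectrum B | algebraMap k[X] B X ∈ v.asIdeal}
      ((Ideal.span {(X : k[X])}).primesOver B) := by
  refine ⟨fun v hv => ?_, fun v _ w _ hvw => HeightOneSpectrum.ext hvw, fun q hq => ?_⟩
  · have := v.isPrime
    exact (mem_primesOver_span_X_iff _).mpr hv
  · have hprime : q.IsPrime := hq.1
    have hX := (mem_primesOver_span_X_iff q).mp hq
    refine ⟨⟨q, hprime, ?_⟩, hX, rfl⟩
    rintro rfl
    exact X_ne_zero ((FaithfulSMul.algebraMap_eq_zero_iff k[X] B).mp ((Ideal.mem_bot).mp hX))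

variable (k B) in
theorem finsum_multiplicity_span_X [IsAlgClosed k] [Module.Finite k[X] B] [FaithfulSMul k[X] B] :
    {v : HeightOneSpectrum B | algebraMap k[X] B X ∈ v.asIdeal}.Finite ∧
      ∑ᶠ v ∈ {v : HeightOneSpectrum B | algebraMap k[X] B X ∈ v.asIdeal},
        (multiplicity v.asIdeal (Ideal.span {algebraMap k[X] B X}) : ℤ) =
      Module.finrank k[X] B := by
  have hbij := bijOn_asIdeal_primesOver_span_X k B
  have : (Ideal.span {(X : k[X])}).IsMaximal :=
    PrincipalIdealRing.isMaximal_of_irreducible irreducible_X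
  have hfree : Module.Free k[X] B := Module.free_of_finite_type_torsion_free'
  have hfin : Finite ((Ideal.span {(X : k[X])}).primesOver B) :=
    Algebra.QuasiFinite.finite_primesOver _
  let := Fintype.ofFinite ((Ideal.span {(X : k[X])}).primesOver B)
  have hmap : (Ideal.span {(X : k[X])}).map (algebraMap k[X] B) =
      Ideal.span {algebraMap k[X] B X} := by
    rw [Ideal.map_span, Set.image_singleton]
  have hmap0 : (Ideal.span {(X : k[X])}).map (algebraMap k[X] B) ≠ ⊥ := by
    rw [hmap, ne_eq, Ideal.span_singleton_eq_bot, FaithfulSMul.algebraMap_eq_zero_iff]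
    exact X_ne_zero
  refine ⟨hbij.finite_iff_finite.mpr hfin, ?_⟩
  rw [finsum_mem_eq_of_bijOn (g := fun q : Ideal B => (q.ramificationIdx k[X] : ℤ)) _ hbij,
    ← finsum_set_coe_eq_finsum_mem, finsum_eq_sum_of_fintype,
    ← Ideal.sum_ramification_inertia_eq_finrank (Ideal.span {(X : k[X])}) B, Nat.cast_sum]
  · refine Finset.sum_congr rfl fun ⟨q, hq, hqX⟩ _ => ?_
    rw [inertiaDeg_eq_one_of_liesOver_span_X, mul_one]
  · intro v hv
    have := v.isPrime
    have := ((mem_primesOver_span_X_iff _).mpr hv).2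
    rw [Ideal.IsDedekindDomain.ramificationIdx_eq_multiplicity (Ideal.span {(X : k[X])}) _ hmap0,
      hmap]

end FinitePolynomial

theorem support_max_zero {α : Type*} (f : α → ℤ) :
    (Function.support fun a => max (f a) 0) = {a | 0 < f a} := by
  ext a
  rw [Function.mem_support, ne_eq, max_eq_right_iff, not_le, Set.mem_ofPred_eq]

namespace IsPlaceSystem

variable {k K ι : Type*} [Field k] [Field K] [Algebra k K]
  {A : ι → ValuationSubring K} {ord : ι → K → ℤ}

theorem bijOn_place_ord_pos {B : Type*} [CommRing B] [IsDedekindDomain B] [Algebra B K]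
    [IsFractionRing B K] [Algebra k[X] B] [Algebra.IsIntegral k[X] B] [FaithfulSMul k[X] B]
    [Algebra k[X] K] [IsScalarTower k[X] B K] [IsScalarTower k k[X] K] [Algebra k B]
    [IsScalarTower k B K] (H : IsPlaceSystem k A ord) :
    Set.BijOn H.place {v : HeightOneSpectrum B | algebraMap k[X] B X ∈ v.asIdeal}
      {i | 0 < ord i (algebraMap k[X] K X)} := by
  have hX0 : algebraMap k[X] B X ≠ 0 :=
    (FaithfulSMul.algebraMap_eq_zero_iff k[X] B).not.mpr X_ne_zero
  have hXK : algebraMap k[X] K X = algebraMap B K (algebraMap k[X] B X) :=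
    IsScalarTower.algebraMap_apply _ _ _ _
  have hpos : ∀ v : HeightOneSpectrum B,
      0 < ord (H.place v) (algebraMap k[X] K X) ↔ algebraMap k[X] B X ∈ v.asIdeal := fun v => by
    rw [hXK, H.ord_place_pos_iff v hX0]
  refine ⟨fun v hv => (hpos v).mpr hv, H.place_injective.injOn, fun i hi => ?_⟩
  have hXi : algebraMap k[X] K X ∈ A i := by
    refine (H.ord_nonneg_iff i ?_).mp (le_of_lt hi)
    rwa [hXK, ne_eq, FaithfulSMul.algebraMap_eq_zero_iff]
  have hpoly : ∀ p : k[X], algebraMap k[X] K p ∈ A i := fun p => by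
    rw [← aeval_X_left_apply p, ← aeval_algebraMap_apply, aeval_eq_sum_range]
    refine sum_mem fun n _ => ?_
    rw [Algebra.smul_def]
    exact mul_mem (H.algebraMap_mem i _) (pow_mem hXi n)
  obtain ⟨v, rfl⟩ := H.exists_place_eq (algebraMap_mem_of_isIntegral (R := B) hpoly)
  exact ⟨v, (hpos v).mp hi, rfl⟩

variable [IsAlgClosed k] [CharZero k]

/-- The zeros of `h` are the maximal ideals over `(h)` in the integral closure of `k[h]`, counted
with their ramification indices. -/
theorem finsum_max_ord (H : IsPlaceSystem k A ord) {h : K} (hh : Transcendental k h)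
    [FiniteDimensional (IntermediateField.adjoin k {h}) K] :
    (Function.support fun i => max (ord i h) 0).Finite ∧
      ∑ᶠ i, max (ord i h) 0 = Module.finrank (IntermediateField.adjoin k {h}) K := by
  let F := IntermediateField.adjoin k {h}
  let : Algebra k[X] F := polynomialAlgebraAdjoin h
  let : Algebra k[X] K := polynomialAlgebra h
  have : IsScalarTower k k[X] K := isScalarTower_polynomialAlgebra h
  have : IsScalarTower k[X] F K := isScalarTower_polynomialAlgebraAdjoin h
  have : IsFractionRing k[X] F := isFractionRing_polynomialAlgebraAdjoin hh
  have : CharZero F := charZero_of_injective_algebraMap (algebraMap k F).injective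
  let B := integralClosure k[X] K
  have : IsDedekindDomain B := integralClosure.isDedekindDomain k[X] F K
  have : Module.Finite k[X] B := IsIntegralClosure.finite k[X] F K _
  have : IsFractionRing B K := integralClosure.isFractionRing_of_finite_extension F K
  have : FaithfulSMul k[X] K := (faithfulSMul_iff_algebraMap_injective k[X] K).mpr
    (transcendental_iff_injective.mp hh)
  have hX : algebraMap k[X] K X = h := aeval_X h
  have hbij := H.bijOn_place_ord_pos (B := B)
  obtain ⟨hfin, hsum⟩ := finsum_multiplicity_span_X k B
  rw [hX] at hbij
  rw [← finsum_mem_support, support_max_zero]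
  refine ⟨hbij.finite_iff_finite.mp hfin, ?_⟩
  rw [IsFractionRing.finrank_eq k[X] F B K, ← hsum]
  refine (finsum_mem_eq_of_bijOn _ hbij fun v hv => ?_).symm
  have hv' : 0 < ord (H.place v) h := hbij.mapsTo hv
  rw [max_eq_left hv'.le, ← hX, IsScalarTower.algebraMap_apply k[X] B K, H.ord_place]
  exact (FaithfulSMul.algebraMap_eq_zero_iff k[X] B).not.mpr X_ne_zero

theorem finsum_max_neg_ord (H : IsPlaceSystem k A ord) {h : K} (hh : Transcendental k h)
    [FiniteDimensional (IntermediateField.adjoin k {h}) K] :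
    (Function.support fun i => max (-ord i h) 0).Finite ∧
      ∑ᶠ i, max (-ord i h) 0 = Module.finrank (IntermediateField.adjoin k {h}) K := by
  have hh0 : h ≠ 0 := fun h0 => hh (h0 ▸ isAlgebraic_zero)
  have hadj : IntermediateField.adjoin k {h⁻¹} = IntermediateField.adjoin k {h} := by
    apply le_antisymm <;> rw [IntermediateField.adjoin_simple_le_iff]
    · exact inv_mem (IntermediateField.mem_adjoin_simple_self k h)
    · simpa only [inv_inv] using inv_mem (IntermediateField.mem_adjoin_simple_self k h⁻¹)
  have : FiniteDimensional (IntermediateField.adjoin k {h⁻¹}) K := by rwa [hadj]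
  have hinv := H.finsum_max_ord (h := h⁻¹) fun halg => hh (inv_inv h ▸ halg.inv)
  simp only [H.ord_inv _ hh0] at hinv
  rwa [hadj] at hinv

theorem finsum_ord (H : IsPlaceSystem k A ord)
    (hfin : ∀ h : K, Transcendental k h → FiniteDimensional (IntermediateField.adjoin k {h}) K)
    {f : K} (hf : f ≠ 0) :
    (Function.support fun i => ord i f).Finite ∧ ∑ᶠ i, ord i f = 0 := by
  by_cases hh : Transcendental k f
  · have := hfin f hh
    obtain ⟨hzeros, hzeros_sum⟩ := H.finsum_max_ord hh
    obtain ⟨hpoles, hpoles_sum⟩ := H.finsum_max_neg_ord hh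
    have hsplit : (fun i => ord i f) = fun i => max (ord i f) 0 - max (-ord i f) 0 := by
      ext i
      omega
    rw [hsplit, finsum_sub_distrib hzeros hpoles, hzeros_sum, hpoles_sum, sub_self]
    exact ⟨(hzeros.union hpoles).subset (Function.support_sub _ _), rfl⟩
  · obtain ⟨c, rfl⟩ := exists_algebraMap_eq_of_isAlgebraic (not_not.mp hh)
    have hc : c ≠ 0 := by
      rintro rfl
      exact hf (map_zero _)
    simp [H.ord_algebraMap _ hc]

theorem finsum_neg_min_ord (H : IsPlaceSystem k A ord)
    (hfin : ∀ h : K, Transcendental k h → FiniteDimensional (IntermediateField.adjoin k {h}) K)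
    {f g : K} (hf : f ≠ 0) (hg : g ≠ 0) (hfg : Transcendental k (f / g)) :
    (Function.support fun i => -min (ord i f) (ord i g)).Finite ∧
      ∑ᶠ i, -min (ord i f) (ord i g) =
        Module.finrank (IntermediateField.adjoin k {f / g}) K := by
  have := hfin _ hfg
  obtain ⟨hpoles, hpoles_sum⟩ := H.finsum_max_neg_ord hfg
  obtain ⟨hord, hord_sum⟩ := H.finsum_ord hfin hg
  have hsplit : (fun i => -min (ord i f) (ord i g)) =
      fun i => max (-ord i (f / g)) 0 - ord i g := by
    ext i
    rw [H.ord_div i hf hg]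
    omega
  rw [hsplit, finsum_sub_distrib hpoles hord, hpoles_sum, hord_sum, sub_zero]
  exact ⟨(hpoles.union hord).subset (Function.support_sub _ _), rfl⟩

end IsPlaceSystem

end PlacesOfFunctionFields

section EtaleAlgebra

variable {T B : Type*} [CommRing T] [CommRing B] [Algebra T B]
  [Algebra.Etale T B]

theorem isPrincipal_maximalIdeal_of_etale [IsPrincipalIdealRing T] (q : Ideal B) [q.IsPrime] :
    (IsLocalRing.maximalIdeal (Localization.AtPrime q)).IsPrincipal := by
  have hq : Algebra.IsUnramifiedAt T q :=
    Algebra.FormallyUnramified.comp T B (Localization.AtPrime q)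
  let : Algebra (Localization.AtPrime (q.under T)) (Localization.AtPrime q) :=
    (Localization.localRingHom (q.under T) q (algebraMap T B) rfl).toAlgebra
  have : Localization.AtPrime.IsLiesOverAlgebra (q.under T) q := ⟨rfl⟩
  rw [← ((Algebra.isUnramifiedAt_iff_map_eq T (q.under T) q).1 hq).2]
  obtain ⟨a, ha⟩ := (IsPrincipalIdealRing.principal (q.under T)).principal
  rw [show q.under T = Ideal.span {a} from ha, Ideal.map_span, Set.image_singleton]
  infer_instance

theorem algebraMap_injective_of_etale [IsDomain T] [IsDomain B] :
    Function.Injective (algebraMap T B) :=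
  FaithfulSMul.algebraMap_injective T B

theorem isAlgebraic_of_etale [IsDomain T] [IsDomain B] (K : Type*) [Field K] [Algebra B K]
    [IsFractionRing B K] [Algebra T K] [IsScalarTower T B K] : Algebra.IsAlgebraic T K := by
  have hinj : Function.Injective (algebraMap T K) := by
    rw [IsScalarTower.algebraMap_eq T B K]
    exact (IsFractionRing.injective B K).comp algebraMap_injective_of_etale
  have : FaithfulSMul T K := (faithfulSMul_iff_algebraMap_injective T K).2 hinj
  let := FractionRing.liftAlgebra T K
  have : IsScalarTower T (FractionRing T) K := inferInstance
  have : Algebra.FormallyUnramified B K := .of_isLocalization (nonZeroDivisors B)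
  have : Algebra.FormallyUnramified T K := .comp T B K
  have : Algebra.FormallyUnramified (FractionRing T) K := .of_restrictScalars T _ _
  have : Algebra.EssFiniteType B K := .of_isLocalization K (nonZeroDivisors B)
  have : Algebra.EssFiniteType T K := .comp T B K
  have : Algebra.EssFiniteType (FractionRing T) K := .of_comp T _ _
  have : Module.Finite (FractionRing T) K := Algebra.FormallyUnramified.finite_of_free _ _
  exact (IsFractionRing.comap_isAlgebraic_iff (K := FractionRing T)).2 inferInstance

end EtaleAlgebra

theorem isPrincipalIdealRing_mvPolynomial_fin_one (k : Type*) [Field k] :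
    IsPrincipalIdealRing (MvPolynomial (Fin 1) k) :=
  .of_surjective (MvPolynomial.uniqueAlgEquiv k (Fin 1)).symm.toRingHom
    (MvPolynomial.uniqueAlgEquiv k (Fin 1)).symm.surjective

section CurveAlgebra

universe u

variable {k K : Type u} {B : Type*} [Field k] [CommRing B] [Algebra k B]
  [Field K] [Algebra B K] [IsFractionRing B K] [Algebra k K] [IsScalarTower k B K]

theorem trdeg_le_one_of_etale [IsDomain B] {g : MvPolynomial (Fin 1) k →ₐ[k] B}
    (hg : g.toRingHom.Etale) :
    Algebra.trdeg k K ≤ 1 := by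
  algebraize [g.toRingHom]
  let : Algebra (MvPolynomial (Fin 1) k) K := ((algebraMap B K).comp g.toRingHom).toAlgebra
  have : IsScalarTower (MvPolynomial (Fin 1) k) B K := .of_algebraMap_eq' rfl
  have : Algebra.IsAlgebraic (MvPolynomial (Fin 1) k) K := isAlgebraic_of_etale (B := B) K
  have hinj : Function.Injective (algebraMap (MvPolynomial (Fin 1) k) K) := by
    rw [IsScalarTower.algebraMap_eq _ B K]
    exact (IsFractionRing.injective B K).comp algebraMap_injective_of_etale
  have : FaithfulSMul (MvPolynomial (Fin 1) k) K :=
    (faithfulSMul_iff_algebraMap_injective _ K).2 hinj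
  have : IsScalarTower k (MvPolynomial (Fin 1) k) K := .of_algebraMap_eq' <| by
    rw [IsScalarTower.algebraMap_eq k B K, ← g.comp_algebraMap]; rfl
  rw [← trdeg_add_eq k (MvPolynomial (Fin 1) k), MvPolynomial.trdeg_of_isDomain,
    trdeg_eq_zero, add_zero, Cardinal.mk_fin, Nat.cast_one, Cardinal.lift_one]

variable (K) in
theorem essFiniteType_of_etale {g : MvPolynomial (Fin 1) k →ₐ[k] B} (hg : g.toRingHom.Etale) :
    Algebra.EssFiniteType k K := by
  algebraize [g.toRingHom]
  have : IsScalarTower k (MvPolynomial (Fin 1) k) B := .of_algebraMap_eq' g.comp_algebraMap.symm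
  have : Algebra.FiniteType (MvPolynomial (Fin 1) k) B := inferInstance
  have : Algebra.FiniteType k B := .trans (S := MvPolynomial (Fin 1) k) inferInstance this
  have : Algebra.EssFiniteType B K := .of_isLocalization K (nonZeroDivisors B)
  exact .comp k B K

end CurveAlgebra

theorem finiteDimensional_adjoin_of_trdeg_le_one {k K : Type*} [Field k] [Field K] [Algebra k K]
    [Algebra.EssFiniteType k K] (h : Algebra.trdeg k K ≤ 1) {x : K} (hx : Transcendental k x) :
    FiniteDimensional (IntermediateField.adjoin k {x}) K := by
  have hb : IsTranscendenceBasis k fun _ : Unit => x :=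
    ((algebraicIndependent_singleton_iff ()).2 hx).isTranscendenceBasis_of_lift_trdeg_le_of_finite
      (by simpa using h)
  have := hb.isAlgebraic_field
  rw [Set.range_const] at this
  have : Algebra.EssFiniteType (IntermediateField.adjoin k {x}) K := .of_comp k _ _
  exact Algebra.finite_of_essFiniteType_of_isAlgebraic

theorem not_algebraicIndependent_of_trdeg_le_one {k K : Type*} [Field k] [Field K] [Algebra k K]
    (h : Algebra.trdeg k K ≤ 1) (w : Fin 2 → K) : ¬ AlgebraicIndependent k w := by
  intro hw
  have h2 : (2 : Cardinal) ≤ Algebra.trdeg k K := by simpa using hw.lift_cardinalMk_le_trdeg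
  exact absurd (h2.trans h) (by norm_num)

section Curve

variable (C : Scheme.{0}) [C.Over (Spec (.of ℂ))]

/-- The structure map `ℂ → Γ(C, U)`. -/
def scalar (U : C.Opens) : ℂ →+* Γ(C, U) :=
  ((C ↘ Spec (.of ℂ)).appLE ⊤ U le_top).hom.comp (Scheme.ΓSpecIso (.of ℂ)).inv.hom

/-- The structure map `ℂ → 𝒪_{C, x}`. -/
def stalkScalar (x : C) : CommRingCat.of ℂ ⟶ C.presheaf.stalk x :=
  (Scheme.ΓSpecIso (.of ℂ)).inv ≫ (C ↘ Spec (.of ℂ)).appTop ≫ C.presheaf.germ ⊤ x trivial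

theorem germ_scalar_eq_stalkScalar {U : C.Opens} {x : C} (hx : x ∈ U) (c : ℂ) :
    C.presheaf.germ U x hx (scalar C U c) = stalkScalar C x c := by
  simp only [scalar, Scheme.Hom.appLE, RingHom.comp_apply, CommRingCat.hom_comp]
  exact C.presheaf.germ_res_apply (homOfLE le_top) _ _ _

theorem fromSpecStalk_comp_over (x : C) :
    C.fromSpecStalk x ≫ (C ↘ Spec (.of ℂ)) = Spec.map (stalkScalar C x) := by
  have h : C.toSpecΓ ≫ Spec.map ((Scheme.ΓSpecIso (.of ℂ)).inv ≫ (C ↘ Spec (.of ℂ)).appTop) =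
      C ↘ Spec (.of ℂ) := by
    rw [Spec.map_comp, ← Scheme.toSpecΓ_naturality_assoc, ← SpecMap_ΓSpecIso_hom, ← Spec.map_comp,
      Iso.inv_hom_id, Spec.map_id, Category.comp_id]
  rw [stalkScalar, ← Category.assoc, Spec.map_comp, ← Scheme.fromSpecStalk_toSpecΓ,
    Category.assoc, h]

variable [IsSmoothProjectiveCurve C]

theorem germ_scalar {U : C.Opens} [Nonempty U] (c : ℂ) :
    C.germToFunctionField U (scalar C U c) = algebraMap ℂ C.functionField c := by
  simp only [scalar, Scheme.Hom.appLE, RingHom.comp_apply, CommRingCat.hom_comp]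
  exact C.presheaf.germ_res_apply (homOfLE le_top) _ _ _

theorem exists_etale_chart (x : C) : ∃ U : C.Opens, IsAffineOpen U ∧ x ∈ U ∧
    ∃ g : MvPolynomial (Fin 1) ℂ →+* Γ(C, U), g.comp MvPolynomial.C = scalar C U ∧ g.Etale := by
  obtain ⟨W, hW, U, hU, hx, e, h⟩ :=
    SmoothOfRelativeDimension.exists_isStandardSmoothOfRelativeDimension (n := 1)
      (f := C ↘ Spec (.of ℂ)) x
  have hW : W = ⊤ := by
    refine top_le_iff.1 fun y _ => ?_
    have : Subsingleton (Spec (.of ℂ)) := inferInstanceAs (Subsingleton (PrimeSpectrum ℂ))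
    rw [Subsingleton.elim y ((C ↘ Spec (.of ℂ)) x)]
    exact e hx
  subst hW
  refine ⟨U, hU, hx, RingHom.IsStandardSmoothOfRelativeDimension.exists_etale_mvPolynomial ?_⟩
  unfold scalar
  have := RingHom.isStandardSmoothOfRelativeDimension_respectsIso (n := 1)
  exact this.2 _ (Scheme.ΓSpecIso (.of ℂ)).symm.commRingCatIsoToRingEquiv h

theorem algebraMap_stalkScalar (x : C) (c : ℂ) :
    algebraMap (C.presheaf.stalk x) C.functionField (stalkScalar C x c) =
      algebraMap ℂ C.functionField c := by
  have : Nonempty (⊤ : C.Opens) := ⟨⟨x, trivial⟩⟩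
  exact C.algebraMap_germ_eq_germToFunctionField (U := ⊤) (x := x) trivial _

variable {C} in
theorem exists_sub_stalkScalar_mem {x : C} (hx : IsClosed {x}) (a : C.presheaf.stalk x) :
    ∃ c : ℂ, a - stalkScalar C x c ∈ IsLocalRing.maximalIdeal (C.presheaf.stalk x) := by
  let e := residueFieldIsoBase (C ↘ Spec (.of ℂ)) x hx
  have he : e.inv = stalkScalar C x ≫ C.residue x := by
    apply Spec.map_injective
    rw [SpecMap_residueFieldIsoBase_inv, Spec.map_comp, ← fromSpecStalk_comp_over]
    simp [Scheme.fromSpecResidueField]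
  refine ⟨e.hom (C.residue x a), ?_⟩
  rw [← IsLocalRing.residue_eq_zero_iff, map_sub, sub_eq_zero]
  exact (e.hom_inv_id_apply _).symm.trans congr($he (e.hom (C.residue x a)))

variable {C} in
theorem not_isField_stalk {x : C} (hx : IsClosed {x}) : ¬ IsField (C.presheaf.stalk x) := by
  intro hf
  obtain ⟨U, -, hxU, g, hg, het⟩ := exists_etale_chart C x
  have : Nonempty U := ⟨⟨x, hxU⟩⟩
  have hinj : Function.Injective g := by
    algebraize [g]
    exact algebraMap_injective_of_etale
  obtain ⟨c, hc⟩ := exists_sub_stalkScalar_mem hx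
    (C.presheaf.germ U x hxU (g (MvPolynomial.X 0)))
  rw [IsLocalRing.isField_iff_maximalIdeal_eq.1 hf, Ideal.mem_bot, sub_eq_zero,
    ← germ_scalar_eq_stalkScalar C hxU, ← hg] at hc
  have hXC : (MvPolynomial.X 0 : MvPolynomial (Fin 1) ℂ) = MvPolynomial.C c :=
    hinj (germ_injective_of_isIntegral _ x hxU hc)
  simpa using congrArg MvPolynomial.totalDegree hXC

theorem isPrincipal_maximalIdeal_stalk (x : C) :
    (IsLocalRing.maximalIdeal (C.presheaf.stalk x)).IsPrincipal := by
  obtain ⟨U, hU, hxU, g, -, het⟩ := exists_etale_chart C x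
  have : Nonempty U := ⟨⟨x, hxU⟩⟩
  let := C.presheaf.algebra_section_stalk ⟨x, hxU⟩
  have hloc := hU.isLocalization_stalk ⟨x, hxU⟩
  let q := (hU.primeIdealOf ⟨x, hxU⟩).asIdeal
  obtain ⟨t, ht⟩ : (IsLocalRing.maximalIdeal (Localization.AtPrime q)).IsPrincipal := by
    have := isPrincipalIdealRing_mvPolynomial_fin_one ℂ
    algebraize [g]
    exact isPrincipal_maximalIdeal_of_etale (T := MvPolynomial (Fin 1) ℂ) q
  let e := IsLocalization.algEquiv q.primeCompl (Localization.AtPrime q) (C.presheaf.stalk x)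
  refine ⟨e t, ?_⟩
  rw [← IsLocalization.AtPrime.map_eq_maximalIdeal q, ← e.toAlgHom.comp_algebraMap,
    ← Ideal.map_map, IsLocalization.AtPrime.map_eq_maximalIdeal q, ht]
  exact (Ideal.map_span _ _).trans (by simp)

variable {C} in
theorem isDiscreteValuationRing_stalk {x : C} (hx : IsClosed {x}) :
    IsDiscreteValuationRing (C.presheaf.stalk x) :=
  ((IsDiscreteValuationRing.TFAE _ (not_isField_stalk hx)).out 0 4).2
    (isPrincipal_maximalIdeal_stalk C x)

theorem exists_etale_isFractionRing_functionField :
    ∃ (B : Type) (_ : CommRing B) (_ : IsDomain B) (_ : Algebra ℂ B)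
      (_ : Algebra B C.functionField) (_ : IsFractionRing B C.functionField)
      (_ : IsScalarTower ℂ B C.functionField) (g : MvPolynomial (Fin 1) ℂ →ₐ[ℂ] B),
      g.toRingHom.Etale := by
  obtain ⟨U, hU, hxU, g, hg, het⟩ := exists_etale_chart C (genericPoint C)
  have : Nonempty U := ⟨⟨_, hxU⟩⟩
  let := (scalar C U).toAlgebra
  exact ⟨Γ(C, U), inferInstance, inferInstance, inferInstance, inferInstance,
    functionField_isFractionRing_of_isAffineOpen C U hU,
    .of_algebraMap_eq fun c => (germ_scalar C c).symm,
    { g with commutes' := fun c => congr($hg c) }, het⟩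

theorem trdeg_functionField_le_one : Algebra.trdeg ℂ C.functionField ≤ 1 := by
  obtain ⟨B, _, _, _, _, _, _, g, hg⟩ := exists_etale_isFractionRing_functionField C
  exact trdeg_le_one_of_etale hg

theorem essFiniteType_functionField : Algebra.EssFiniteType ℂ C.functionField := by
  obtain ⟨B, _, _, _, _, _, _, g, hg⟩ := exists_etale_isFractionRing_functionField C
  exact essFiniteType_of_etale _ hg

end Curve

section Places

variable {C : Scheme.{0}} [C.Over (Spec (.of ℂ))] [IsSmoothProjectiveCurve C]

theorem coheight_eq_one {x : C} (hx : IsClosed {x}) : Order.coheight x = 1 := by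
  have := isDiscreteValuationRing_stalk hx
  have h := IsDiscreteValuationRing.ringKrullDim_eq_one (C.presheaf.stalk x)
  rw [ringKrullDim_stalk_eq_coheight] at h
  exact_mod_cast h

theorem ord_nonneg_iff {x : C} (hx : IsClosed {x}) {f : C.functionField} (hf : f ≠ 0) :
    0 ≤ C.ord f x ↔ f ∈ (algebraMap (C.presheaf.stalk x) C.functionField).range := by
  have := isDiscreteValuationRing_stalk hx
  rw [Scheme.le_ord_iff (coheight_eq_one hx) hf, ofAdd_zero, WithZero.coe_one, Scheme.ordHom,
    Ring.ordFrac_eq_valuation_inv, one_le_inv₀ (by simpa [WithZero.pos_iff_ne_zero])]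
  constructor
  · exact IsDiscreteValuationRing.exists_lift_of_le_one
  · rintro ⟨a, rfl⟩
    exact IsDedekindDomain.HeightOneSpectrum.valuation_le_one _ a

theorem exists_ord_eq_one {x : C} (hx : IsClosed {x}) :
    ∃ t : C.functionField, t ≠ 0 ∧ C.ord t x = 1 := by
  have := isDiscreteValuationRing_stalk hx
  obtain ⟨t, ht⟩ := IsDiscreteValuationRing.exists_irreducible (C.presheaf.stalk x)
  have ht0 : algebraMap (C.presheaf.stalk x) C.functionField t ≠ 0 := by
    simpa using ht.ne_zero
  refine ⟨_, ht0, ?_⟩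
  rw [Scheme.ord_eq_iff (coheight_eq_one hx) ht0]
  exact Ring.ordFrac_irreducible ht

/-- The local ring of a closed point, as a valuation ring of the function field. -/
def placeRing (x : {x : C // IsClosed {x}}) : ValuationSubring C.functionField :=
  { (algebraMap (C.presheaf.stalk x.1) C.functionField).range with
    mem_or_inv_mem' := fun f => by
      have := isDiscreteValuationRing_stalk x.2
      exact ValuationRing.isInteger_or_isInteger (C.presheaf.stalk x.1) f }

section ValuativeCriterion

variable (B : ValuationSubring C.functionField)

/-- The generic point of `C` and a valuation ring of `K(C)` over `ℂ`, as a valuative square. -/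
def valuativeSquare (hB : ∀ c : ℂ, algebraMap ℂ C.functionField c ∈ B) :
    ValuativeCommSq (C ↘ Spec (.of ℂ)) where
  R := B
  K := C.functionField
  i₁ := C.fromSpecStalk (genericPoint C)
  i₂ := Spec.map (CommRingCat.ofHom ((algebraMap ℂ C.functionField).codRestrict B.toSubring hB))
  commSq := ⟨by
    rw [fromSpecStalk_comp_over, ← Spec.map_comp]
    rfl⟩

/-- The morphism `Spec B ⟶ C` given by an inclusion `𝒪_{C, x} ⊆ B`. -/
def specToCurve {x : C}
    (h : ∀ a, algebraMap (C.presheaf.stalk x) C.functionField a ∈ B) : Spec (.of B) ⟶ C :=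
  Spec.map (CommRingCat.ofHom
    ((algebraMap (C.presheaf.stalk x) C.functionField).codRestrict B.toSubring h)) ≫
      C.fromSpecStalk x

theorem specToCurve_lift {x : C}
    (h : ∀ a, algebraMap (C.presheaf.stalk x) C.functionField a ∈ B) :
    Spec.map (CommRingCat.ofHom (algebraMap B C.functionField)) ≫ specToCurve B h =
      C.fromSpecStalk (genericPoint C) := by
  rw [specToCurve, ← Spec.map_comp_assoc,
    ← C.SpecMap_stalkSpecializes_fromSpecStalk ((genericPoint_spec C).specializes trivial)]
  rfl

theorem specToCurve_comp (hB : ∀ c : ℂ, algebraMap ℂ C.functionField c ∈ B) {x : C}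
    (h : ∀ a, algebraMap (C.presheaf.stalk x) C.functionField a ∈ B) :
    specToCurve B h ≫ (C ↘ Spec (.of ℂ)) = (valuativeSquare B hB).i₂ := by
  rw [specToCurve, Category.assoc, fromSpecStalk_comp_over, ← Spec.map_comp]
  congr 1
  ext c
  exact congrArg Subtype.val (Subtype.ext (algebraMap_stalkScalar C x c) :
    (⟨_, h (stalkScalar C x c)⟩ : B) = ⟨_, hB c⟩)

theorem specToCurve_closedPoint {x : {x : C // IsClosed {x}}} (hx : placeRing x = B)
    (h : ∀ a, algebraMap (C.presheaf.stalk x.1) C.functionField a ∈ B) :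
    specToCurve B h (IsLocalRing.closedPoint B) = x := by
  have : IsLocalHom
      ((algebraMap (C.presheaf.stalk x.1) C.functionField).codRestrict B.toSubring h) := by
    refine ⟨fun a ha => ?_⟩
    obtain ⟨⟨b, hbB⟩, hb⟩ := ha.exists_right_inv
    rw [← hx] at hbB
    obtain ⟨b, rfl⟩ := hbB
    refine .of_mul_eq_one b (IsFractionRing.injective (C.presheaf.stalk x.1) C.functionField ?_)
    rw [map_mul, map_one]
    exact congrArg Subtype.val hb
  have : IsLocalRing B.toSubring := inferInstanceAs (IsLocalRing B)
  exact (congrArg (C.fromSpecStalk x.1) (IsLocalRing.comap_closedPoint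
    ((algebraMap (C.presheaf.stalk x.1) C.functionField).codRestrict B.toSubring h))).trans
    Scheme.fromSpecStalk_closedPoint

end ValuativeCriterion

theorem algebraMap_mem_placeRing (x : {x : C // IsClosed {x}}) (c : ℂ) :
    algebraMap ℂ C.functionField c ∈ placeRing x :=
  ⟨stalkScalar C x.1 c, algebraMap_stalkScalar C x.1 c⟩

theorem placeRing_injective : Function.Injective (placeRing (C := C)) := by
  intro x y h
  have hsub := IsSeparated.valuativeCriterion (C ↘ Spec (.of ℂ))
    (valuativeSquare (placeRing x) (algebraMap_mem_placeRing x))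
  have hlift := congrArg CommSq.LiftStruct.l (hsub.elim
    ⟨specToCurve (placeRing x) fun a => ⟨a, rfl⟩, specToCurve_lift _ _,
      specToCurve_comp _ (algebraMap_mem_placeRing x) _⟩
    ⟨specToCurve (placeRing x) (x := y.1) (fun a => h ▸ ⟨a, rfl⟩), specToCurve_lift _ _,
      specToCurve_comp _ (algebraMap_mem_placeRing x) _⟩)
  have hclosed := congrArg (fun l : Spec (.of (placeRing x)) ⟶ C =>
    l (IsLocalRing.closedPoint (placeRing x))) hlift
  exact Subtype.ext <| (specToCurve_closedPoint _ rfl _).symm.trans <|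
    hclosed.trans (specToCurve_closedPoint _ h.symm _)

variable (C) in
theorem compactSpace_curve : CompactSpace C := by
  have : QuasiCompact (C ↘ Spec (.of ℂ)) := inferInstance
  exact QuasiCompact.compactSpace_of_compactSpace (C ↘ Spec (.of ℂ))

theorem exists_forall_algebraMap_stalk_mem (B : ValuationSubring C.functionField)
    (hB : ∀ c : ℂ, algebraMap ℂ C.functionField c ∈ B) :
    ∃ y : C, ∀ a, algebraMap (C.presheaf.stalk y) C.functionField a ∈ B := by
  have hex : ValuativeCriterion.Existence (C ↘ Spec (.of ℂ)) := by
    have : UniversallyClosed (C ↘ Spec (.of ℂ)) := inferInstance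
    rw [UniversallyClosed.eq_valuativeCriterion] at this
    exact this.1
  obtain ⟨⟨(l : Spec (.of B) ⟶ C), hl, -⟩⟩ := hex (valuativeSquare B hB)
  have hstalk : Scheme.stalkClosedPointTo l ≫ CommRingCat.ofHom (algebraMap B C.functionField) =
      C.presheaf.stalkSpecializes ((genericPoint_spec C).specializes trivial) := by
    apply Spec.map_injective
    rw [← cancel_mono (C.fromSpecStalk _), Scheme.SpecMap_stalkSpecializes_fromSpecStalk,
      Spec.map_comp, Category.assoc, Scheme.Spec_stalkClosedPointTo_fromSpecStalk]
    exact hl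
  refine ⟨l (IsLocalRing.closedPoint B), fun a => ?_⟩
  have ha := congr($hstalk a)
  exact ha ▸ (Scheme.stalkClosedPointTo l a).2

theorem exists_placeRing_le (B : ValuationSubring C.functionField)
    (hB : ∀ c : ℂ, algebraMap ℂ C.functionField c ∈ B) : ∃ x, placeRing (C := C) x ≤ B := by
  obtain ⟨y, hy⟩ := exists_forall_algebraMap_stalk_mem B hB
  have := compactSpace_curve C
  obtain ⟨x, hxy, hx⟩ := isClosed_closure.exists_closed_singleton (S := closure {y})
    (closure_nonempty_iff.2 ⟨y, rfl⟩)
  refine ⟨⟨x, hx⟩, ?_⟩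
  rintro _ ⟨a, rfl⟩
  have hs : y ⤳ x := specializes_iff_mem_closure.2 hxy
  have hcomp := C.presheaf.stalkSpecializes_comp ((genericPoint_spec C).specializes trivial) hs
  have ha : algebraMap (C.presheaf.stalk y) C.functionField (C.presheaf.stalkSpecializes hs a) =
      algebraMap (C.presheaf.stalk x) C.functionField a := congr($hcomp a)
  exact ha ▸ hy _

theorem krullDimLE_one_placeRing (x : {x : C // IsClosed {x}}) :
    Ring.KrullDimLE 1 (placeRing x) := by
  have := isDiscreteValuationRing_stalk x.2
  let e : C.presheaf.stalk x.1 ≃+* placeRing x := RingEquiv.ofBijective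
    ((algebraMap (C.presheaf.stalk x.1) C.functionField).codRestrict (placeRing x).toSubring
      fun a => ⟨a, rfl⟩)
    ⟨fun a b h => IsFractionRing.injective (C.presheaf.stalk x.1) C.functionField
      (congrArg Subtype.val h), fun ⟨_, a, ha⟩ => ⟨a, Subtype.ext ha⟩⟩
  rw [Ring.krullDimLE_iff, ← ringKrullDim_eq_of_ringEquiv e,
    IsDiscreteValuationRing.ringKrullDim_eq_one]
  rfl

variable (C) in
theorem isPlaceSystem_placeRing :
    IsPlaceSystem ℂ (placeRing (C := C)) fun x f => C.ord f x.1 where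
  ord_mul x _ _ hf hg := Scheme.ord_mul hf hg
  ord_nonneg_iff x _ hf := ord_nonneg_iff x.2 hf
  exists_ord_eq_one x := exists_ord_eq_one x.2
  algebraMap_mem := algebraMap_mem_placeRing
  injective := placeRing_injective
  surjective B hB hne := by
    obtain ⟨x, hx⟩ := exists_placeRing_le B hB
    have := krullDimLE_one_placeRing x
    exact ⟨x, ValuationSubring.eq_of_le_of_ne_top _ hx hne⟩

theorem finiteDimensional_functionField {h : C.functionField} (hh : Transcendental ℂ h) :
    FiniteDimensional (IntermediateField.adjoin ℂ {h}) C.functionField :=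
  have := essFiniteType_functionField C
  finiteDimensional_adjoin_of_trdeg_le_one (trdeg_functionField_le_one C) hh

end Places

section Coordinates

open HomogeneousLocalization

section Chart

attribute [local instance] MvPolynomial.gradedAlgebra

/-- The grading of `k[X₀, X₁, X₂]` by degree. -/
abbrev planeGrading (k : Type*) [Field k] : ℕ → Submodule k (MvPolynomial (Fin 3) k) :=
  MvPolynomial.homogeneousSubmodule (Fin 3) k

variable {k : Type*} [Field k] (j : Fin 3) (a : Fin 2 → k)

variable (k) in
theorem X_mem_planeGrading : MvPolynomial.X j ∈ planeGrading k 1 :=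
  MvPolynomial.isHomogeneous_X k j

/-- The affine coordinates `Xᵢ / Xⱼ - aᵢ` with `i ≠ j` on the chart `Xⱼ ≠ 0` of the plane. -/
def chartCoordinates :
    MvPolynomial (Fin 2) k →+* Away (planeGrading k) (MvPolynomial.X j) :=
  let c : k →+* Away (planeGrading k) (MvPolynomial.X j) :=
    (fromZeroRingHom (planeGrading k) _).comp (algebraMap k (planeGrading k 0))
  MvPolynomial.eval₂Hom c fun i =>
    Away.mk (planeGrading k) (X_mem_planeGrading k j) 1 (MvPolynomial.X (j.succAbove i))
      (X_mem_planeGrading k _) - c (a i)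

/-- The inverse of the coordinates `chartCoordinates j a` on homogeneous polynomials: it sets
`Xⱼ = 1` and moves the point `a` to the origin. -/
def dehomogenize : MvPolynomial (Fin 3) k →ₐ[k] MvPolynomial (Fin 2) k :=
  MvPolynomial.aeval (j.insertNth 1 fun i => MvPolynomial.X i + MvPolynomial.C (a i))

theorem dehomogenize_X_self : dehomogenize j a (MvPolynomial.X j) = 1 := by
  simp [dehomogenize]

theorem dehomogenize_X_succAbove (i : Fin 2) :
    dehomogenize j a (MvPolynomial.X (j.succAbove i)) =
      MvPolynomial.X i + MvPolynomial.C (a i) := by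
  simp [dehomogenize]

variable (k) in
/-- The fraction `Xᵢ / Xⱼ` in the localization of `k[X₀, X₁, X₂]` away from `Xⱼ`. -/
def awayFraction (i : Fin 3) : Localization.Away (MvPolynomial.X j : MvPolynomial (Fin 3) k) :=
  IsLocalization.mk' (M := Submonoid.powers (MvPolynomial.X (R := k) j)) _ (MvPolynomial.X i)
    ⟨MvPolynomial.X j, Submonoid.mem_powers _⟩

theorem awayFraction_self : awayFraction k j j = 1 :=
  IsLocalization.mk'_self _ (Submonoid.mem_powers _)

theorem algebraMap_X_mul_awayFraction (i : Fin 3) :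
    algebraMap (MvPolynomial (Fin 3) k) _ (MvPolynomial.X j) * awayFraction k j i =
      algebraMap (MvPolynomial (Fin 3) k) _ (MvPolynomial.X i) := by
  rw [mul_comm, awayFraction]
  exact IsLocalization.mk'_spec (M := Submonoid.powers (MvPolynomial.X (R := k) j)) _
    (MvPolynomial.X i) ⟨MvPolynomial.X j, Submonoid.mem_powers _⟩

theorem map_X_mul_lift_awayFraction {P : Type*} [CommRing P] {g : MvPolynomial (Fin 3) k →+* P}
    (hg : IsUnit (g (MvPolynomial.X j))) (i : Fin 3) :
    g (MvPolynomial.X j) * IsLocalization.Away.lift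
      (S := Localization.Away (MvPolynomial.X j : MvPolynomial (Fin 3) k)) _ hg
        (awayFraction k j i) = g (MvPolynomial.X i) := by
  have h := congrArg (IsLocalization.Away.lift
    (S := Localization.Away (MvPolynomial.X j : MvPolynomial (Fin 3) k)) _ hg)
      (algebraMap_X_mul_awayFraction (k := k) j i)
  rwa [map_mul, IsLocalization.Away.lift_eq, IsLocalization.Away.lift_eq] at h

theorem aeval_mul_of_isHomogeneous {σ S : Type*} [CommRing S] [Algebra k S] {p : MvPolynomial σ k}
    {n : ℕ} (hp : p.IsHomogeneous n) (c : S) (g : σ → S) :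
    MvPolynomial.aeval (fun i => c * g i) p = c ^ n * MvPolynomial.aeval g p := by
  rw [MvPolynomial.aeval_def, MvPolynomial.aeval_def, MvPolynomial.eval₂_eq, MvPolynomial.eval₂_eq,
    Finset.mul_sum]
  refine Finset.sum_congr rfl fun d hd => ?_
  rw [Finset.prod_congr rfl fun i _ => mul_pow c (g i) (d i), Finset.prod_mul_distrib,
    Finset.prod_pow_eq_pow_sum, ← hp.degree_eq_sum_deg_support hd]
  ring

theorem val_fromZeroRingHom_algebraMap (t : MvPolynomial (Fin 3) k) (c : k) :
    (fromZeroRingHom (planeGrading k) (Submonoid.powers t)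
      (algebraMap k (planeGrading k 0) c)).val = algebraMap k (Localization.Away t) c := by
  rw [IsScalarTower.algebraMap_apply k (MvPolynomial (Fin 3) k) (Localization.Away t)]
  exact Localization.mk_one_eq_algebraMap _

theorem algebraMap_comp_chartCoordinates :
    (algebraMap (Away (planeGrading k) (MvPolynomial.X j))
      (Localization.Away (MvPolynomial.X j : MvPolynomial (Fin 3) k))).comp (chartCoordinates j a) =
    (MvPolynomial.aeval (R := k) fun i =>
      awayFraction k j (j.succAbove i) - algebraMap k _ (a i)).toRingHom := by
  refine MvPolynomial.ringHom_ext (fun c => ?_) fun i => ?_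
  · simp [chartCoordinates, val_fromZeroRingHom_algebraMap]
  · simp [chartCoordinates, val_fromZeroRingHom_algebraMap, Localization.mk_eq_mk', awayFraction]

variable {j} in
/-- The evaluation on the chart `Xⱼ ≠ 0` at a point `[s₀ : s₁ : s₂]` with `sⱼ ≠ 0`. -/
def evalAway {K : Type*} [Field K] [Algebra k K] {s : Fin 3 → K} (hs : s j ≠ 0) :
    Away (planeGrading k) (MvPolynomial.X j) →+* K :=
  (IsLocalization.Away.lift (S := Localization.Away (MvPolynomial.X j : MvPolynomial (Fin 3) k))
    (MvPolynomial.X j) (g := (MvPolynomial.aeval (R := k) s).toRingHom)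
    (by simpa using hs)).comp (algebraMap _ _)

theorem evalAway_comp_chartCoordinates {K : Type*} [Field K] [Algebra k K] {s : Fin 3 → K}
    (hs : s j ≠ 0) : (evalAway hs).comp (chartCoordinates j a) =
      (MvPolynomial.aeval (R := k) fun i =>
        s (j.succAbove i) / s j - algebraMap k K (a i)).toRingHom := by
  rw [evalAway, RingHom.comp_assoc, algebraMap_comp_chartCoordinates]
  refine MvPolynomial.ringHom_ext (fun c => ?_) fun i => ?_
  · simp [IsScalarTower.algebraMap_apply k (MvPolynomial (Fin 3) k) (Localization.Away _)]
  · have h := map_X_mul_lift_awayFraction j (g := (MvPolynomial.aeval (R := k) s).toRingHom)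
      (by simpa using hs) (j.succAbove i)
    simp only [AlgHom.toRingHom_eq_coe, RingHom.coe_coe, MvPolynomial.aeval_X] at h
    simp [IsScalarTower.algebraMap_apply k (MvPolynomial (Fin 3) k) (Localization.Away _),
      eq_div_iff hs, mul_comm _ (s j), h]

theorem chartCoordinates_injective : Function.Injective (chartCoordinates j a) := by
  have hunit : IsUnit ((dehomogenize j a).toRingHom (MvPolynomial.X j)) := by
    simp [dehomogenize_X_self]
  let l := IsLocalization.Away.lift
    (S := Localization.Away (MvPolynomial.X j : MvPolynomial (Fin 3) k)) _ hunit
  have hl : (l.comp (algebraMap _ _)).comp (chartCoordinates j a) = RingHom.id _ := by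
    rw [RingHom.comp_assoc, algebraMap_comp_chartCoordinates]
    refine MvPolynomial.ringHom_ext (fun c => ?_) fun i => ?_
    · simp [IsScalarTower.algebraMap_apply k (MvPolynomial (Fin 3) k) (Localization.Away _), l]
    · have h := map_X_mul_lift_awayFraction j hunit (j.succAbove i)
      simp only [AlgHom.toRingHom_eq_coe, RingHom.coe_coe, dehomogenize_X_self, one_mul,
        dehomogenize_X_succAbove] at h
      simp [IsScalarTower.algebraMap_apply k (MvPolynomial (Fin 3) k) (Localization.Away _), l, h]
  exact Function.LeftInverse.injective (g := l.comp (algebraMap _ _)) fun p => congr($hl p)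

theorem aeval_awayFraction_comp_dehomogenize :
    (MvPolynomial.aeval (R := k) fun i =>
      awayFraction k j (j.succAbove i) - algebraMap k _ (a i)).comp (dehomogenize j a) =
    MvPolynomial.aeval (awayFraction k j) := by
  refine MvPolynomial.algHom_ext fun i => ?_
  obtain rfl | ⟨i, rfl⟩ := j.eq_self_or_eq_succAbove i
  · rw [AlgHom.comp_apply, dehomogenize_X_self, map_one, MvPolynomial.aeval_X, awayFraction_self]
  · simp [dehomogenize_X_succAbove]

theorem algebraMap_X_pow_mul_aeval_awayFraction {p : MvPolynomial (Fin 3) k} {n : ℕ}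
    (hp : p.IsHomogeneous n) :
    algebraMap (MvPolynomial (Fin 3) k) (Localization.Away (MvPolynomial.X j))
      (MvPolynomial.X j) ^ n * MvPolynomial.aeval (awayFraction k j) p = algebraMap _ _ p := by
  rw [← aeval_mul_of_isHomogeneous hp, funext (algebraMap_X_mul_awayFraction j)]
  exact congr($((MvPolynomial.aeval_unique (IsScalarTower.toAlgHom k (MvPolynomial (Fin 3) k)
    (Localization.Away (MvPolynomial.X j : MvPolynomial (Fin 3) k)))).symm) p)

theorem chartCoordinates_dehomogenize {p : MvPolynomial (Fin 3) k} {n : ℕ}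
    (hp : p ∈ planeGrading k (n • 1)) :
    chartCoordinates j a (dehomogenize j a p) =
      Away.mk (planeGrading k) (X_mem_planeGrading k j) n p hp := by
  refine val_injective _ ((congr($(algebraMap_comp_chartCoordinates j a) (dehomogenize j a p)).trans
    congr($(aeval_awayFraction_comp_dehomogenize j a) p)).trans ?_)
  rw [smul_eq_mul, mul_one] at hp
  rw [Away.val_mk, Localization.mk_eq_mk', IsLocalization.eq_mk'_iff_mul_eq, map_pow, mul_comm,
    algebraMap_X_pow_mul_aeval_awayFraction j hp]

theorem chartCoordinates_bijective : Function.Bijective (chartCoordinates j a) := by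
  refine ⟨chartCoordinates_injective j a, fun z => ?_⟩
  obtain ⟨n, p, hp, rfl⟩ := Away.mk_surjective (planeGrading k) (X_mem_planeGrading k j) z
  exact ⟨dehomogenize j a p, chartCoordinates_dehomogenize j a hp⟩

end Chart

section GenericPoint

attribute [local instance] MvPolynomial.gradedAlgebra

theorem toSpecΓ_restrict_basicOpen {X : Scheme.{0}} (x : Γ(X, ⊤)) :
    (X.isoOfEq (X.toSpecΓ_preimage_basicOpen x)).inv ≫ X.toSpecΓ ∣_ _ ≫
      (basicOpenIsoSpecAway (R := Γ(X, ⊤)) x).hom ≫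
        Spec.map (CommRingCat.ofHom (algebraMap Γ(X, ⊤) (Localization.Away x))) =
      (X.basicOpen x).ι ≫ X.toSpecΓ :=
  calc
    _ = (X.isoOfEq (X.toSpecΓ_preimage_basicOpen x)).inv ≫ X.toSpecΓ ∣_ _ ≫
        Scheme.Opens.ι (X := Spec Γ(X, ⊤)) (PrimeSpectrum.basicOpen x) := by
      have h := basicOpenIsoSpecAway_hom_SpecMap (R := Γ(X, ⊤)) x
      congr 2
    _ = (X.isoOfEq (X.toSpecΓ_preimage_basicOpen x)).inv ≫
        (X.toSpecΓ ⁻¹ᵁ (PrimeSpectrum.basicOpen x)).ι ≫ X.toSpecΓ :=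
      congrArg (_ ≫ ·) (morphismRestrict_ι X.toSpecΓ _)
    _ = _ := X.isoOfEq_inv_ι_assoc _ _

theorem toBasicOpenOfGlobalSections_eq {X : Scheme.{0}} {A σ : Type} [CommRing A]
    [SetLike σ A] [AddSubgroupClass σ A] {𝒜 : ℕ → σ} [GradedRing 𝒜] (f : A →+* Γ(X, ⊤)) {t : A}
    {d : ℕ} (h0 : 0 < d) (hd : t ∈ 𝒜 d) {R : CommRingCat.{0}} (e : Localization.Away t →+* R)
    (g : Γ(X, ⊤) ⟶ R) (p : Spec R ⟶ (X.basicOpen (f t)).toScheme)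
    (hp : p ≫ (X.basicOpen (f t)).ι ≫ X.toSpecΓ = Spec.map g)
    (he : e.comp (algebraMap _ _) = g.hom.comp f) :
    p ≫ Proj.toBasicOpenOfGlobalSections 𝒜 f rfl h0 hd ≫ (Proj.basicOpen 𝒜 t).ι =
      Spec.map (CommRingCat.ofHom (e.comp (algebraMap (Away 𝒜 t) (Localization.Away t)))) ≫
        Proj.awayι 𝒜 t hd h0 := by
  let x := f t
  obtain ⟨g', hg'⟩ := Spec.map_surjective (p ≫ (X.isoOfEq (X.toSpecΓ_preimage_basicOpen x)).inv ≫
    X.toSpecΓ ∣_ _ ≫ (basicOpenIsoSpecAway (R := Γ(X, ⊤)) x).hom)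
  have hgg : CommRingCat.ofHom (algebraMap Γ(X, ⊤) (Localization.Away x)) ≫ g' = g := by
    apply Spec.map_injective
    rw [Spec.map_comp, hg', ← hp]
    exact congrArg (p ≫ ·) (toSpecΓ_restrict_basicOpen x)
  have hge : g'.hom.comp (IsLocalization.map (M := .powers t) (T := .powers x)
      (S := Localization.Away t) (Localization.Away x) f
      (by rw [← Submonoid.map_le_iff_le_comap, Submonoid.map_powers])) = e := by
    refine IsLocalization.ringHom_ext (Submonoid.powers t) ?_
    rw [he, ← hgg, RingHom.comp_assoc, IsLocalization.map_comp]
    rfl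
  rw [← hge, RingHom.comp_assoc, CommRingCat.ofHom_comp, CommRingCat.ofHom_hom, Spec.map_comp, hg',
    Proj.toBasicOpenOfGlobalSections]
  simp only [Category.assoc]
  rfl

theorem SpecMap_awayToSection_awayι (k : Type) [Field k] (j : Fin 3) :
    Spec.map (Proj.awayToSection (planeGrading k) (MvPolynomial.X j)) ≫
        Proj.awayι (planeGrading k) (MvPolynomial.X j) (X_mem_planeGrading k j) one_pos =
      (Proj.isAffineOpen_basicOpen (planeGrading k) _ (X_mem_planeGrading k j)
        one_pos).fromSpec := by
  let hU := Proj.isAffineOpen_basicOpen (planeGrading k) _ (X_mem_planeGrading k j) one_pos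
  rw [← cancel_epi hU.isoSpec.hom, IsAffineOpen.fromSpec, Iso.hom_inv_id_assoc, Proj.awayι,
    ← Category.assoc, ← Category.assoc]
  have hiso : hU.isoSpec.hom ≫
      Spec.map (Proj.awayToSection (planeGrading k) (MvPolynomial.X j)) =
      (Proj.basicOpenIsoSpec (planeGrading k) _ (X_mem_planeGrading k j) one_pos).hom := by
    rw [Proj.basicOpenIsoSpec_hom, Proj.basicOpenToSpec]
    rfl
  rw [hiso, Iso.hom_inv_id, Category.id_comp]

variable {C : Scheme.{0}} [C.Over (Spec (.of ℂ))] [IsSmoothProjectiveCurve C]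
  {s : Fin 3 → C.functionField} {j : Fin 3}

theorem genericCoordinates_eq (hj : s j ≠ 0) (hs : s ≠ 0) :
    genericCoordinates s hs = Spec.map (CommRingCat.ofHom (evalAway (k := ℂ) hj)) ≫
      Proj.awayι (planeGrading ℂ) (MvPolynomial.X j) (X_mem_planeGrading ℂ j) one_pos := by
  let K := C.functionField
  let f := evalTriple s
  have hunit : IsUnit (f (MvPolynomial.X j)) := by
    refine IsUnit.map (Scheme.ΓSpecIso K).inv.hom ?_
    rw [AlgHom.toRingHom_eq_coe, RingHom.coe_coe, MvPolynomial.aeval_X]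
    exact IsUnit.mk0 _ hj
  have htop : (Spec K).basicOpen (f (MvPolynomial.X j)) = ⊤ :=
    Scheme.basicOpen_of_isUnit _ hunit
  let p : Spec K ⟶ ((Spec K).basicOpen (f (MvPolynomial.X j))).toScheme :=
    (Scheme.topIso _).inv ≫ (Scheme.isoOfEq _ htop).inv
  have hp : p ≫ Scheme.Opens.ι _ = 𝟙 _ := by simp [p]
  have hglobal := Proj.fromOfGlobalSections_resLE (planeGrading ℂ) f
    (map_irrelevant_evalTriple s hs) one_pos (X_mem_planeGrading ℂ j)
  have hlocal := toBasicOpenOfGlobalSections_eq (𝒜 := planeGrading ℂ) f one_pos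
    (X_mem_planeGrading ℂ j)
    (IsLocalization.Away.lift (S := Localization.Away (MvPolynomial.X j : MvPolynomial (Fin 3) ℂ))
      (MvPolynomial.X j) (g := (MvPolynomial.aeval (R := ℂ) s).toRingHom) (by simpa using hj))
    (Scheme.ΓSpecIso K).hom p
    (by rw [reassoc_of% hp, SpecMap_ΓSpecIso_hom])
    (by
      rw [IsLocalization.Away.lift_comp]
      exact RingHom.ext fun q => ((Scheme.ΓSpecIso K).inv_hom_id_apply _).symm)
  rw [← hglobal] at hlocal
  refine Eq.trans ?_ hlocal
  rw [Scheme.Hom.resLE_comp_ι, reassoc_of% hp]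
  rfl

variable {hs : s ≠ 0} {q : Plane} {τ : Plane.presheaf.stalk q ⟶ C.functionField}

theorem ne_zero_of_mem_basicOpen (hτ : Spec.map τ ≫ Plane.fromSpecStalk q = genericCoordinates s hs)
    (hq : q ∈ Proj.basicOpen (planeGrading ℂ) (MvPolynomial.X j)) : s j ≠ 0 := by
  intro h0
  have hpreimage := Proj.fromOfGlobalSections_preimage_basicOpen (planeGrading ℂ)
    (evalTriple s) (map_irrelevant_evalTriple s hs) one_pos (X_mem_planeGrading ℂ j)
  have hX : evalTriple s (MvPolynomial.X j) = 0 := by simp [evalTriple, h0]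
  rw [hX, Scheme.basicOpen_zero] at hpreimage
  have hmem : IsLocalRing.closedPoint C.functionField ∈
      genericCoordinates s hs ⁻¹ᵁ Proj.basicOpen (planeGrading ℂ) (MvPolynomial.X j) := by
    rw [← hτ]
    have hspec : Plane.fromSpecStalk q (Spec.map τ (IsLocalRing.closedPoint _)) ⤳ q := by
      have := Set.mem_range_self (f := Plane.fromSpecStalk q)
        (Spec.map τ (IsLocalRing.closedPoint _))
      rwa [Scheme.range_fromSpecStalk] at this
    exact hspec.mem_open (Proj.basicOpen (planeGrading ℂ) (MvPolynomial.X j)).2 hq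
  exact (hpreimage ▸ hmem : _ ∈ (⊥ : (Spec C.functionField).Opens))

theorem awayToSection_germ_comp (hτ : Spec.map τ ≫ Plane.fromSpecStalk q = genericCoordinates s hs)
    (hq : q ∈ Proj.basicOpen (planeGrading ℂ) (MvPolynomial.X j)) (hj : s j ≠ 0) :
    Proj.awayToSection (planeGrading ℂ) (MvPolynomial.X j) ≫
      Plane.presheaf.germ _ q hq ≫ τ = CommRingCat.ofHom (evalAway (k := ℂ) hj) := by
  let hU := Proj.isAffineOpen_basicOpen (planeGrading ℂ) _ (X_mem_planeGrading ℂ j) one_pos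
  apply Spec.map_injective
  rw [← cancel_mono (Proj.awayι (planeGrading ℂ) (MvPolynomial.X j) (X_mem_planeGrading ℂ j)
    one_pos), ← genericCoordinates_eq hj hs, ← hτ]
  simp only [Spec.map_comp, Category.assoc]
  rw [SpecMap_awayToSection_awayι]
  exact congrArg (Spec.map τ ≫ ·) (hU.fromSpecStalk_eq_fromSpecStalk hq)

end GenericPoint

end Coordinates

section PlaneMap

attribute [local instance] MvPolynomial.gradedAlgebra

variable {C : Scheme.{0}} [C.Over (Spec (.of ℂ))] [IsSmoothProjectiveCurve C]
  {s : Fin 3 → C.functionField} {hs : s ≠ 0} {φ : C ⟶ Plane}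

theorem isDominant_fromSpecStalk_genericPoint (X : Scheme.{0}) [IrreducibleSpace X] :
    IsDominant (X.fromSpecStalk (genericPoint X)) := by
  refine ⟨fun x => ?_⟩
  have hη : genericPoint X ∈ Set.range (X.fromSpecStalk (genericPoint X)) := by
    rw [Scheme.range_fromSpecStalk]
    exact specializes_rfl
  have hx : x ∈ closure {genericPoint X} :=
    ((genericPoint_spec X).specializes trivial).mem_closure
  exact closure_mono (Set.singleton_subset_iff.2 hη) hx

theorem universallyClosed_of_genericCoordinates
    (hφ : C.fromSpecStalk (genericPoint C) ≫ φ = genericCoordinates s hs) :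
    UniversallyClosed φ := by
  let π : Plane ⟶ Spec (.of ℂ) := Proj.toSpecZero (planeGrading ℂ) ≫
    Spec.map (CommRingCat.ofHom (algebraMap ℂ (planeGrading ℂ 0)))
  have : IsSeparated (Proj.toSpecZero (planeGrading ℂ)) := inferInstance
  have hπ : φ ≫ π = C ↘ Spec (.of ℂ) := by
    have := isDominant_fromSpecStalk_genericPoint C
    refine ext_of_isDominant (C.fromSpecStalk (genericPoint C)) ?_
    rw [reassoc_of% hφ, fromSpecStalk_comp_over, genericCoordinates,
      Proj.fromOfGlobalSections_toSpecZero_assoc, ← SpecMap_ΓSpecIso_hom, ← Spec.map_comp,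
      ← Spec.map_comp]
    congr 1
    ext c
    refine ((Scheme.ΓSpecIso C.functionField).inv_hom_id_apply _).trans ?_
    exact MvPolynomial.aeval_C s c
  have : UniversallyClosed (φ ≫ π) := hπ ▸ inferInstance
  have : IsSeparated π := inferInstance
  exact .of_comp_of_isSeparated φ π

theorem toImage_surjective
    (hφ : C.fromSpecStalk (genericPoint C) ≫ φ = genericCoordinates s hs) :
    Function.Surjective φ.toImage := by
  have := universallyClosed_of_genericCoordinates hφ
  have : UniversallyClosed φ.toImage := inferInstance
  have : IsDominant φ.toImage := inferInstance
  rw [← Set.range_eq_univ, ← φ.toImage.isClosedMap.isClosed_range.closure_eq]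
  exact φ.toImage.denseRange.closure_range

theorem stalkMap_toImage_injective {X Y : Scheme.{0}} [IsIntegral X] (f : X ⟶ Y) [QuasiCompact f]
    (x : X) : Function.Injective (f.toImage.stalkMap x) := by
  obtain ⟨_, ⟨V, hV, rfl⟩, hxV, -⟩ :=
    Y.isBasis_affineOpens.exists_subset_of_mem_open (Set.mem_univ (f x)) isOpen_univ
  have hU : IsAffineOpen (f.imageι ⁻¹ᵁ V) := hV.preimage f.imageι
  refine hU.stalkMap_injective f.toImage x hxV fun g hg => ?_
  replace hg := (Scheme.Hom.germ_stalkMap_apply f.toImage _ x hxV g).symm.trans hg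
  have h0 := germ_injective_of_isIntegral _ x _ (hg.trans (map_zero _).symm)
  rw [f.toImage_app_injective ⟨V, hV⟩ (h0.trans (map_zero _).symm), map_zero]

/-- The pullback of functions from the local ring of the plane at `φ x` to the function field of
the curve. It factors through the local ring of the image of `φ`, whose ideal it computes. -/
def pullback (φ : C ⟶ Plane) (x : C) :
    Plane.presheaf.stalk (φ.imageι (φ.toImage x)) ⟶ C.functionField :=
  φ.imageι.stalkMap (φ.toImage x) ≫ φ.toImage.stalkMap x ≫
    C.presheaf.stalkSpecializes ((genericPoint_spec C).specializes trivial)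

theorem ker_pullback (φ : C ⟶ Plane) [QuasiCompact φ] (x : C) :
    RingHom.ker (pullback φ x).hom = RingHom.ker (φ.imageι.stalkMap (φ.toImage x)).hom := by
  have hinj : Function.Injective (φ.toImage.stalkMap x ≫
      C.presheaf.stalkSpecializes ((genericPoint_spec C).specializes trivial)) :=
    (IsFractionRing.injective (C.presheaf.stalk x) C.functionField).comp
      (stalkMap_toImage_injective φ x)
  ext z
  rw [RingHom.mem_ker, RingHom.mem_ker]
  exact map_eq_zero_iff (φ.toImage.stalkMap x ≫
    C.presheaf.stalkSpecializes ((genericPoint_spec C).specializes trivial)).hom hinj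

theorem SpecMap_pullback (hφ : C.fromSpecStalk (genericPoint C) ≫ φ = genericCoordinates s hs)
    (x : C) : Spec.map (pullback φ x) ≫ Plane.fromSpecStalk (φ.imageι (φ.toImage x)) =
      genericCoordinates s hs := by
  simp only [pullback, Spec.map_comp, Category.assoc]
  rw [Scheme.SpecMap_stalkMap_fromSpecStalk, Scheme.SpecMap_stalkMap_fromSpecStalk_assoc,
    Scheme.SpecMap_stalkSpecializes_fromSpecStalk_assoc, Scheme.Hom.toImage_imageι, hφ]

theorem exists_mem_basicOpen_X (q : Plane) :
    ∃ j, q ∈ Proj.basicOpen (planeGrading ℂ) (MvPolynomial.X j) := by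
  have h := Proj.iSup_basicOpen_eq_top' (planeGrading ℂ) (MvPolynomial.X (R := ℂ))
    (fun i => ⟨1, X_mem_planeGrading ℂ i⟩) (by
      refine top_le_iff.1 fun p _ => ?_
      induction p using MvPolynomial.induction_on with
      | C c => exact Subalgebra.algebraMap_mem _ (algebraMap ℂ (planeGrading ℂ 0) c)
      | add p q hp hq => exact add_mem (hp trivial) (hq trivial)
      | mul_X p i hp => exact mul_mem (hp trivial) (Algebra.subset_adjoin ⟨i, rfl⟩))
  exact TopologicalSpace.Opens.mem_iSup.1 (h.ge (Set.mem_univ q))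

section StalkCoordinates

variable {q : Plane} {j : Fin 3} (hq : q ∈ Proj.basicOpen (planeGrading ℂ) (MvPolynomial.X j))
  (a : Fin 2 → ℂ)

/-- The affine coordinates `Xᵢ / Xⱼ - aᵢ`, as elements of the local ring of the plane at `q`. -/
def stalkCoordinates : MvPolynomial (Fin 2) ℂ →+* Plane.presheaf.stalk q :=
  ((Plane.presheaf.germ _ q hq).hom.comp
    (Proj.awayToSection (planeGrading ℂ) (MvPolynomial.X j)).hom).comp (chartCoordinates j a)

theorem isLocalization_stalkCoordinates {M : Ideal (MvPolynomial (Fin 2) ℂ)} [M.IsPrime]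
    (hM : (IsLocalRing.maximalIdeal (Plane.presheaf.stalk q)).comap (stalkCoordinates hq a) = M) :
    let := (stalkCoordinates hq a).toAlgebra
    IsLocalization.AtPrime (Plane.presheaf.stalk q) M := by
  let U := Proj.basicOpen (planeGrading ℂ) (MvPolynomial.X j)
  let hU : IsAffineOpen U :=
    Proj.isAffineOpen_basicOpen (planeGrading ℂ) _ (X_mem_planeGrading ℂ j) one_pos
  let := Plane.presheaf.algebra_section_stalk ⟨q, hq⟩
  let := (stalkCoordinates hq a).toAlgebra
  have := hU.isLocalization_stalk ⟨q, hq⟩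
  let e : MvPolynomial (Fin 2) ℂ ≃+* Γ(Plane, U) :=
    (RingEquiv.ofBijective _ (chartCoordinates_bijective j a)).trans
      (Proj.basicOpenIsoAway (planeGrading ℂ) _ (X_mem_planeGrading ℂ j)
        one_pos).commRingCatIsoToRingEquiv
  refine IsLocalization.of_ringEquiv_left e (M₁ := (hU.primeIdealOf ⟨q, hq⟩).asIdeal.primeCompl)
    (Submonoid.ext fun y => ?_) fun _ => rfl
  obtain ⟨p, rfl⟩ := e.surjective y
  have hp : p ∈ M ↔ e p ∈ (hU.primeIdealOf ⟨q, hq⟩).asIdeal := by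
    rw [← hM, ← IsLocalization.AtPrime.under_maximalIdeal (Plane.presheaf.stalk q)
      (hU.primeIdealOf ⟨q, hq⟩).asIdeal]
    rfl
  simp [Ideal.primeCompl, hp]

theorem comp_stalkCoordinates {τ : Plane.presheaf.stalk q ⟶ C.functionField}
    (hτ : Spec.map τ ≫ Plane.fromSpecStalk q = genericCoordinates s hs) :
    τ.hom.comp (stalkCoordinates hq a) =
      (MvPolynomial.aeval fun i => s (j.succAbove i) / s j - algebraMap ℂ _ (a i)).toRingHom := by
  have hj := ne_zero_of_mem_basicOpen hτ hq
  rw [← evalAway_comp_chartCoordinates j a hj]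
  have h := awayToSection_germ_comp hτ hq hj
  exact RingHom.ext fun p => congr($h (chartCoordinates j a p))

end StalkCoordinates

end PlaneMap

section LocalEquation

theorem mem_pow_of_mul_mem {R : Type*} [CommRing R] {M : Ideal R} [hM : M.IsMaximal] {f c : R}
    {m : ℕ} (hc : c ∉ M) (h : f * c ∈ M ^ m) : f ∈ M ^ m := by
  rcases eq_or_ne m 0 with rfl | hm
  · simp
  have hrad : (M ^ m).radical = M := by rw [M.radical_pow hm, hM.isPrime.radical]
  have hprimary : (M ^ m).IsPrimary := Ideal.isPrimary_of_isMaximal_radical (by rwa [hrad])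
  exact ((Ideal.isPrimary_iff.1 hprimary).2 h).resolve_right (by rwa [hrad])

theorem algebraMap_mem_maximalIdeal_pow_iff {R : Type*} (O : Type*) [CommRing R] [CommRing O]
    [IsLocalRing O] [Algebra R O] (M : Ideal R) [M.IsMaximal] [IsLocalization.AtPrime O M] {f : R}
    {m : ℕ} : algebraMap R O f ∈ IsLocalRing.maximalIdeal O ^ m ↔ f ∈ M ^ m := by
  rw [← IsLocalization.AtPrime.map_eq_maximalIdeal M O, ← Ideal.map_pow]
  refine ⟨fun h => ?_, Ideal.mem_map_of_mem _⟩
  obtain ⟨⟨i, t⟩, hit⟩ := (IsLocalization.mem_map_algebraMap_iff M.primeCompl O).1 h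
  rw [← map_mul] at hit
  obtain ⟨c, hc⟩ := IsLocalization.exists_of_eq (M := M.primeCompl) hit
  refine mem_pow_of_mul_mem (M.primeCompl.mul_mem c.2 t.2) ?_
  rw [mul_left_comm, hc]
  exact Ideal.mul_mem_left _ _ i.2

theorem ker_le_maximalIdeal_pow_iff {R O L : Type*} [CommRing R] [CommRing O] [IsLocalRing O]
    [CommRing L] [Algebra R O] (M : Ideal R) [M.IsMaximal] [IsLocalization.AtPrime O M]
    {τ : O →+* L} {f : R} (hf : RingHom.ker (τ.comp (algebraMap R O)) = Ideal.span {f}) (m : ℕ) :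
    RingHom.ker τ ≤ IsLocalRing.maximalIdeal O ^ m ↔ f ∈ M ^ m := by
  refine ⟨fun h => (algebraMap_mem_maximalIdeal_pow_iff O M).1
    (h (hf.ge (Ideal.mem_span_singleton_self f))), fun h z hz => ?_⟩
  obtain ⟨⟨p, t⟩, hpt⟩ := IsLocalization.surj M.primeCompl z
  have hp : p ∈ Ideal.span {f} := by
    rw [← hf, RingHom.mem_ker, RingHom.comp_apply, ← hpt, map_mul, (RingHom.mem_ker).1 hz,
      zero_mul]
  have hzt : z * algebraMap R O t ∈ IsLocalRing.maximalIdeal O ^ m :=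
    hpt ▸ (algebraMap_mem_maximalIdeal_pow_iff O M).2 ((Ideal.span_singleton_le_iff_mem _).2 h hp)
  exact (Ideal.mul_unit_mem_iff_mem _ (IsLocalization.map_units O t)).1 hzt

theorem isMaximal_idealOfVars (σ k : Type*) [Field k] :
    (MvPolynomial.idealOfVars σ k).IsMaximal := by
  have hker : MvPolynomial.idealOfVars σ k = RingHom.ker (MvPolynomial.constantCoeff (R := k)) := by
    ext p
    rw [← pow_one (MvPolynomial.idealOfVars σ k), MvPolynomial.mem_pow_idealOfVars_iff',
      RingHom.mem_ker, MvPolynomial.constantCoeff_eq]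
    simp only [Nat.lt_one_iff, Finsupp.degree_eq_zero_iff, forall_eq]
  rw [hker]
  exact RingHom.ker_isMaximal_of_surjective _ fun c =>
    ⟨MvPolynomial.C c, MvPolynomial.constantCoeff_C _ c⟩

theorem adjoin_range_eq_top_of_isLocalization {σ k K O : Type*} [Field k] [Field K] [Algebra k K]
    [CommRing O] [Algebra (MvPolynomial σ k) O] (M : Submonoid (MvPolynomial σ k))
    [IsLocalization M O] {τ : O →+* K} (hτ : Function.Surjective τ) {u : σ → K}
    (hu : τ.comp (algebraMap (MvPolynomial σ k) O) = (MvPolynomial.aeval u).toRingHom) :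
    IntermediateField.adjoin k (Set.range u) = ⊤ := by
  refine top_le_iff.1 fun h _ => ?_
  obtain ⟨z, rfl⟩ := hτ h
  obtain ⟨⟨p, t⟩, hpt⟩ := IsLocalization.surj M z
  have hτu : ∀ q, τ (algebraMap _ O q) = MvPolynomial.aeval u q := fun q => congr($hu q)
  have ht : τ (algebraMap _ O t.1) ≠ 0 := ((IsLocalization.map_units O t).map τ).ne_zero
  rw [IntermediateField.mem_adjoin_range_iff]
  refine ⟨p, t, ?_⟩
  rw [← hτu, ← hτu, eq_div_iff ht, ← map_mul, hpt]

end LocalEquation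

section Image

attribute [local instance] MvPolynomial.gradedAlgebra

variable {C : Scheme.{0}} [C.Over (Spec (.of ℂ))] [IsSmoothProjectiveCurve C]
  {s : Fin 3 → C.functionField} {hs : s ≠ 0} {φ : C ⟶ Plane} {x : C} {j : Fin 3}
  {a : Fin 2 → ℂ}

theorem algebraMap_stalkMap_stalkCoordinates
    (hφ : C.fromSpecStalk (genericPoint C) ≫ φ = genericCoordinates s hs)
    (hx : φ.imageι (φ.toImage x) ∈ Proj.basicOpen (planeGrading ℂ) (MvPolynomial.X j)) (i : Fin 2) :
    algebraMap (C.presheaf.stalk x) C.functionField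
      ((φ.imageι.stalkMap (φ.toImage x) ≫ φ.toImage.stalkMap x).hom
        (stalkCoordinates hx a (MvPolynomial.X i))) =
      s (j.succAbove i) / s j - algebraMap ℂ _ (a i) := by
  have h := congr($(comp_stalkCoordinates hx a (SpecMap_pullback hφ x)) (MvPolynomial.X i))
  simp only [AlgHom.toRingHom_eq_coe, RingHom.coe_coe, MvPolynomial.aeval_X] at h
  exact h

theorem exists_coordinates_mem_maximalIdeal
    (hφ : C.fromSpecStalk (genericPoint C) ≫ φ = genericCoordinates s hs)
    (hxc : IsClosed {x}) (hx : φ x ∈ Proj.basicOpen (planeGrading ℂ) (MvPolynomial.X j)) :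
    ∃ a : Fin 2 → ℂ, ∀ i, ∃ b ∈ IsLocalRing.maximalIdeal (C.presheaf.stalk x),
      algebraMap _ C.functionField b = s (j.succAbove i) / s j - algebraMap ℂ _ (a i) := by
  have hr := algebraMap_stalkMap_stalkCoordinates (x := x) (a := 0) hφ hx
  choose a ha using fun i => exists_sub_stalkScalar_mem hxc
    ((φ.imageι.stalkMap (φ.toImage x) ≫ φ.toImage.stalkMap x).hom
      (stalkCoordinates (q := φ.imageι (φ.toImage x)) hx 0 (MvPolynomial.X i)))
  refine ⟨a, fun i => ⟨_, ha i, ?_⟩⟩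
  rw [map_sub, hr, algebraMap_stalkScalar, Pi.zero_apply, map_zero, sub_zero]

theorem comap_stalkCoordinates_maximalIdeal
    (hφ : C.fromSpecStalk (genericPoint C) ≫ φ = genericCoordinates s hs)
    (hx : φ.imageι (φ.toImage x) ∈ Proj.basicOpen (planeGrading ℂ) (MvPolynomial.X j))
    (ha : ∀ i, ∃ b ∈ IsLocalRing.maximalIdeal (C.presheaf.stalk x),
      algebraMap _ C.functionField b = s (j.succAbove i) / s j - algebraMap ℂ _ (a i)) :
    (IsLocalRing.maximalIdeal (Plane.presheaf.stalk (φ.imageι (φ.toImage x)))).comap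
      (stalkCoordinates hx a) = MvPolynomial.idealOfVars (Fin 2) ℂ := by
  refine ((isMaximal_idealOfVars (Fin 2) ℂ).eq_of_le (Ideal.IsPrime.ne_top inferInstance) ?_).symm
  rw [MvPolynomial.idealOfVars, Ideal.span_le]
  rintro _ ⟨i, rfl⟩
  refine (IsLocalRing.mem_maximalIdeal _).2 fun hunit => ?_
  obtain ⟨b, hb, hbi⟩ := ha i
  have hb' := IsFractionRing.injective (C.presheaf.stalk x) C.functionField
    (hbi.trans (algebraMap_stalkMap_stalkCoordinates hφ hx i).symm)
  exact (IsLocalRing.mem_maximalIdeal _).1 hb (hb' ▸ hunit.map _)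

theorem imageMultiplicity_toImage
    (hφ : C.fromSpecStalk (genericPoint C) ≫ φ = genericCoordinates s hs)
    (hx : φ x ∈ Proj.basicOpen (planeGrading ℂ) (MvPolynomial.X j))
    (ha : ∀ i, ∃ b ∈ IsLocalRing.maximalIdeal (C.presheaf.stalk x),
      algebraMap _ C.functionField b = s (j.succAbove i) / s j - algebraMap ℂ _ (a i))
    {f : MvPolynomial (Fin 2) ℂ} (hf : RingHom.ker (MvPolynomial.aeval (R := ℂ)
      fun i => s (j.succAbove i) / s j - algebraMap ℂ C.functionField (a i)) = Ideal.span {f}) :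
    imageMultiplicity φ (φ.toImage x) = orderAtOrigin f := by
  have := universallyClosed_of_genericCoordinates hφ
  have hx' : φ.imageι (φ.toImage x) ∈ Proj.basicOpen (planeGrading ℂ) (MvPolynomial.X j) := hx
  have := isMaximal_idealOfVars (Fin 2) ℂ
  let := (stalkCoordinates hx' a).toAlgebra
  have := isLocalization_stalkCoordinates hx' a (comap_stalkCoordinates_maximalIdeal hφ hx' ha)
  have hker := (congrArg RingHom.ker (comp_stalkCoordinates hx' a (SpecMap_pullback hφ x))).trans hf
  rw [imageMultiplicity, ← ker_pullback, orderAtOrigin]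
  simp only [ker_le_maximalIdeal_pow_iff (MvPolynomial.idealOfVars (Fin 2) ℂ) hker]

theorem isIso_stalkMap_genericPoint {X Y : Scheme.{0}} [IsIntegral X] {f : X ⟶ Y}
    (hf : IsBirationalMorphism f) : IsIso (f.stalkMap (genericPoint X)) := by
  obtain ⟨e, he⟩ := hf
  obtain ⟨W, hW, hWl, hWr, h⟩ := Scheme.PartialMap.toRationalMap_eq_iff.1 he
  have hη : genericPoint X ∈ W := by
    obtain ⟨y, hy⟩ := hW.nonempty
    exact ((genericPoint_spec X).specializes trivial).mem_open W.2 hy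
  have hWl' : W ≤ e.source := hWl
  have hWr' : W ≤ ⊤ := hWr
  have hf : X.homOfLE hWl' ≫ e.iso.hom ≫ e.target.ι = X.homOfLE hWr' ≫ (⊤ : X.Opens).ι ≫ f := by
    simp only [Scheme.PartialMap.restrict_hom, Scheme.PartialIso.toPartialMap_hom,
      Scheme.Hom.toPartialMap_hom] at h
    exact h
  rw [Scheme.homOfLE_ι_assoc] at hf
  have : IsOpenImmersion (W.ι ≫ f) := hf ▸ inferInstance
  let w : W.toScheme := ⟨genericPoint X, hη⟩
  have hcomp : IsIso ((W.ι ≫ f).stalkMap w) := inferInstance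
  have : IsIso (f.stalkMap (W.ι w) ≫ W.ι.stalkMap w) := by
    rw [← Scheme.Hom.stalkMap_comp]
    exact hcomp
  exact IsIso.of_isIso_comp_right (f.stalkMap (W.ι w)) (W.ι.stalkMap w)

theorem pullback_genericPoint_surjective (hbir : IsBirationalMorphism φ.toImage) :
    Function.Surjective (pullback φ (genericPoint C)).hom := by
  have := isIso_stalkMap_genericPoint hbir
  have hstalk : Function.Surjective (φ.toImage.stalkMap (genericPoint C)) :=
    (ConcreteCategory.bijective_of_isIso _).2
  have hspec : Function.Surjective (C.presheaf.stalkSpecializes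
      ((genericPoint_spec C).specializes trivial : genericPoint C ⤳ genericPoint C)) := by
    rw [TopCat.Presheaf.stalkSpecializes_refl]
    exact fun y => ⟨y, rfl⟩
  exact (hspec.comp hstalk).comp (φ.imageι.stalkMap_surjective _)

theorem adjoin_coordinates_eq_top
    (hφ : C.fromSpecStalk (genericPoint C) ≫ φ = genericCoordinates s hs)
    (hbir : IsBirationalMorphism φ.toImage)
    (hx : φ x ∈ Proj.basicOpen (planeGrading ℂ) (MvPolynomial.X j)) :
    IntermediateField.adjoin ℂ (Set.range fun i => s (j.succAbove i) / s j) = ⊤ := by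
  have hη : φ.imageι (φ.toImage (genericPoint C)) ∈
      Proj.basicOpen (planeGrading ℂ) (MvPolynomial.X j) :=
    ((genericPoint_spec C).specializes trivial).mem_open
      (φ ⁻¹ᵁ (Proj.basicOpen (planeGrading ℂ) (MvPolynomial.X j))).2 hx
  let := (stalkCoordinates hη 0).toAlgebra
  have := isLocalization_stalkCoordinates hη 0 rfl
  have hadjoin := adjoin_range_eq_top_of_isLocalization (k := ℂ) (K := C.functionField)
    (Ideal.primeCompl ((IsLocalRing.maximalIdeal _).comap (stalkCoordinates hη 0)))
    (pullback_genericPoint_surjective hbir)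
    (comp_stalkCoordinates hη 0 (SpecMap_pullback hφ (genericPoint C)))
  rwa [adjoin_range_sub_algebraMap 0 fun i => s (j.succAbove i) / s j] at hadjoin

end Image

section Valuation

variable {R K : Type*} [CommRing R] [Field K] [Algebra R K] {A : ValuationSubring K}

theorem valuation_smul_le (hA : ∀ c : R, algebraMap R K c ∈ A) (c : R) (f : K) :
    A.valuation (c • f) ≤ A.valuation f := by
  rw [Algebra.smul_def, map_mul]
  exact mul_le_of_le_one_left' ((A.valuation_le_one_iff _).2 (hA c))

theorem valuation_le_of_mem_span (hA : ∀ c : R, algebraMap R K c ∈ A) {S : Set K} {f w : K}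
    (hS : ∀ g ∈ S, A.valuation g ≤ A.valuation w) (hf : f ∈ Submodule.span R S) :
    A.valuation f ≤ A.valuation w := by
  induction hf using Submodule.span_induction with
  | mem f hf => exact hS f hf
  | zero => simp
  | add f g _ _ hf hg => exact (A.valuation.map_add f g).trans (max_le hf hg)
  | smul c f _ hf => exact (valuation_smul_le hA c f).trans hf

theorem valuation_lt_of_mem_span (hA : ∀ c : R, algebraMap R K c ∈ A) {S : Set K} {f w : K}
    (hw : w ≠ 0) (hS : ∀ g ∈ S, A.valuation g < A.valuation w) (hf : f ∈ Submodule.span R S) :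
    A.valuation f < A.valuation w := by
  induction hf using Submodule.span_induction with
  | mem f hf => exact hS f hf
  | zero => simpa [zero_lt_iff] using hw
  | add f g _ _ hf hg => exact A.valuation.map_add_lt hf hg
  | smul c f _ hf => exact (valuation_smul_le hA c f).trans_lt hf

theorem span_eq_setOf_valuation_le (hA : Set.range (algebraMap R K) = A) {S : Set K} {w : K}
    (hw : w ∈ S) (hw0 : w ≠ 0) (hS : ∀ v ∈ S, A.valuation v ≤ A.valuation w) :
    (Submodule.span R S : Set K) = {f | A.valuation f ≤ A.valuation w} := by
  have hR (c : R) : algebraMap R K c ∈ A := hA.le (Set.mem_range_self c)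
  refine Set.Subset.antisymm (fun f hf => valuation_le_of_mem_span hR hS hf) fun f hf => ?_
  have hfw : f / w ∈ A := by
    rw [← A.valuation_le_one_iff, map_div₀]
    exact div_le_one_of_le₀ hf zero_le
  obtain ⟨c, hc⟩ := hA.ge hfw
  rw [eq_div_iff hw0, ← Algebra.smul_def] at hc
  exact hc ▸ Submodule.smul_mem _ c (Submodule.subset_span hw)

theorem valuation_algebraMap_lt_one [IsLocalRing R] (hinj : Function.Injective (algebraMap R K))
    (hA : Set.range (algebraMap R K) = A) {b : R} (hb : b ∈ IsLocalRing.maximalIdeal R) :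
    A.valuation (algebraMap R K b) < 1 := by
  refine lt_of_le_of_ne ((A.valuation_le_one_iff _).2 (hA.le (Set.mem_range_self b))) fun hone => ?_
  obtain ⟨c, hc⟩ : (algebraMap R K b)⁻¹ ∈ Set.range (algebraMap R K) := by
    rw [hA, SetLike.mem_coe, ← A.valuation_le_one_iff, map_inv₀, hone, inv_one]
  have hb0 : algebraMap R K b ≠ 0 := fun h0 => by simp [h0] at hone
  have hbc : b * c = 1 := hinj (by rw [map_mul, hc, map_one, mul_inv_cancel₀ hb0])
  exact (IsLocalRing.mem_maximalIdeal _).1 hb (.of_mul_eq_one c hbc)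

end Valuation

section ValuationField

variable {k K : Type*} [Field k] [Field K] [Algebra k K] {A : ValuationSubring K}

theorem valuation_aeval_sub_lt_one (hA : ∀ c : k, algebraMap k K c ∈ A) {σ : Type*} {u : σ → K}
    {a : σ → k} (hu : ∀ i, A.valuation (u i - algebraMap k K (a i)) < 1) (p : MvPolynomial σ k) :
    A.valuation (MvPolynomial.aeval u p - algebraMap k K (MvPolynomial.eval a p)) < 1 := by
  have hle (c : k) : A.valuation (algebraMap k K c) ≤ 1 := (A.valuation_le_one_iff _).2 (hA c)
  induction p using MvPolynomial.induction_on with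
  | C c => simp
  | add p q hp hq =>
    rw [map_add, map_add, map_add, add_sub_add_comm]
    exact A.valuation.map_add_lt hp hq
  | mul_X p i hp =>
    have haeval : A.valuation (MvPolynomial.aeval u p) ≤ 1 := by
      rw [← sub_add_cancel (MvPolynomial.aeval u p) (algebraMap k K (MvPolynomial.eval a p))]
      exact A.valuation.map_add_le hp.le (hle _)
    have hsplit : MvPolynomial.aeval u (p * MvPolynomial.X i) -
        algebraMap k K (MvPolynomial.eval a (p * MvPolynomial.X i)) =
        MvPolynomial.aeval u p * (u i - algebraMap k K (a i)) +
          algebraMap k K (a i) *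
            (MvPolynomial.aeval u p - algebraMap k K (MvPolynomial.eval a p)) := by
      simp only [map_mul, MvPolynomial.aeval_X, MvPolynomial.eval_X]
      ring
    rw [hsplit]
    refine A.valuation.map_add_lt ?_ ?_ <;> rw [map_mul]
    · exact mul_lt_one_of_nonneg_of_lt_one_right haeval zero_le (hu i)
    · exact mul_lt_one_of_nonneg_of_lt_one_right (hle _) zero_le hp

theorem eval_eq_zero_of_aeval_eq_zero (hA : ∀ c : k, algebraMap k K c ∈ A) {σ : Type*} {u : σ → K}
    {a : σ → k} (hu : ∀ i, A.valuation (u i - algebraMap k K (a i)) < 1) {p : MvPolynomial σ k}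
    (hp : MvPolynomial.aeval u p = 0) : MvPolynomial.eval a p = 0 := by
  by_contra hc
  have hlt := valuation_aeval_sub_lt_one hA hu p
  have hinv := (A.valuation_le_one_iff _).2 (hA (MvPolynomial.eval a p)⁻¹)
  rw [hp, zero_sub, Valuation.map_neg] at hlt
  rw [map_inv₀, map_inv₀, inv_le_one₀ (by simpa [zero_lt_iff] using hc)] at hinv
  exact hinv.not_gt hlt

theorem transcendental_div_of_linearIndependent [IsAlgClosed k] {f g : K}
    (h : LinearIndependent k ![f, g]) : Transcendental k (g / f) := by
  intro hfg
  obtain ⟨c, hc⟩ := exists_algebraMap_eq_of_isAlgebraic hfg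
  have hf : f ≠ 0 := h.ne_zero 0
  rw [eq_div_iff hf, ← Algebra.smul_def] at hc
  have hneg := (LinearIndependent.pair_iff.1 h c (-1) (by simp [hc])).2
  exact neg_ne_zero.2 one_ne_zero hneg

theorem div_sub_algebraMap {h : K} (hh : h ≠ 0) (f : K) (c : k) :
    f / h - algebraMap k K c = (f - c • h) / h := by
  rw [Algebra.smul_def, sub_div, mul_div_cancel_right₀ _ hh]

theorem valuation_div_sub_algebraMap_lt_one_iff {h : K} (hh : h ≠ 0) (f : K) (c : k) :
    A.valuation (f / h - algebraMap k K c) < 1 ↔ A.valuation (f - c • h) < A.valuation h := by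
  rw [div_sub_algebraMap hh, map_div₀, div_lt_one₀ (by simpa [zero_lt_iff] using hh)]

end ValuationField

section Triple

variable {k K : Type*} [Field k] [AddCommGroup K] [Module k K] {f g h : K}

theorem linearIndependent_triple_iff : LinearIndependent k ![f, g, h] ↔
    ∀ a b c : k, a • f + b • g + c • h = 0 → a = 0 ∧ b = 0 ∧ c = 0 := by
  rw [Fintype.linearIndependent_iff]
  constructor
  · intro H a b c habc
    have hcoeff := H ![a, b, c] (by simpa [Fin.sum_univ_three] using habc)
    exact ⟨hcoeff 0, hcoeff 1, hcoeff 2⟩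
  · intro H a ha i
    obtain ⟨h0, h1, h2⟩ := H (a 0) (a 1) (a 2) (by simpa [Fin.sum_univ_three] using ha)
    fin_cases i
    exacts [h0, h1, h2]

theorem linearIndependent_triple_sub (H : LinearIndependent k ![f, g, h]) (a b : k) :
    LinearIndependent k ![f - a • h, g - b • h, h] := by
  rw [linearIndependent_triple_iff] at H ⊢
  intro x y z hxyz
  obtain ⟨rfl, rfl, hz⟩ := H x y (z - x * a - y * b) (by rw [← hxyz]; module)
  exact ⟨rfl, rfl, by simpa using hz⟩

theorem span_triple_sub (a b : k) :
    Submodule.span k {f - a • h, g - b • h, h} = Submodule.span k {f, g, h} := by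
  apply le_antisymm <;> intro w hw <;> rw [Submodule.mem_span_triple] at hw ⊢ <;>
    obtain ⟨x, y, z, rfl⟩ := hw
  · exact ⟨x, y, z - x * a - y * b, by module⟩
  · exact ⟨x, y, z + x * a + y * b, by module⟩

theorem linearIndependent_pair_of_triple (H : LinearIndependent k ![f, g, h]) :
    LinearIndependent k ![f, g] := by
  rw [linearIndependent_triple_iff] at H
  refine LinearIndependent.pair_iff.2 fun x y hxy => ?_
  obtain ⟨hx, hy, -⟩ := H x y 0 (by simpa using hxy)
  exact ⟨hx, hy⟩

theorem notMem_span_pair_of_triple (H : LinearIndependent k ![f, g, h]) :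
    h ∉ Submodule.span k {f, g} := by
  rw [linearIndependent_triple_iff] at H
  intro hh
  obtain ⟨x, y, hxy⟩ := Submodule.mem_span_pair.1 hh
  exact neg_ne_zero.2 one_ne_zero (H x y (-1) (by rw [hxy]; simp)).2.2

theorem linearIndependent_triple_succAbove {s : Fin 3 → K} (hs : LinearIndependent k s)
    (j : Fin 3) : LinearIndependent k ![s (j.succAbove 0), s (j.succAbove 1), s j] := by
  rw [linearIndependent_triple_iff]
  intro x y z hxyz
  have hcoeff := Fintype.linearIndependent_iff.1 hs (j.insertNth z ![x, y]) (by
    rw [Fin.sum_univ_succAbove _ j, Fin.sum_univ_two]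
    simp only [Fin.insertNth_apply_same, Fin.insertNth_apply_succAbove]
    rw [← hxyz]
    simp only [Matrix.cons_val_zero, Matrix.cons_val_one]
    abel)
  exact ⟨by simpa using hcoeff (j.succAbove 0), by simpa using hcoeff (j.succAbove 1),
    by simpa using hcoeff j⟩

theorem span_triple_succAbove (s : Fin 3 → K) (j : Fin 3) :
    Submodule.span k {s (j.succAbove 0), s (j.succAbove 1), s j} =
      Submodule.span k (Set.range s) := by
  congr 1
  ext w
  fin_cases j <;> simp [Fin.exists_fin_succ, Fin.succAbove] <;> tauto

theorem finrank_span_pair_of_triple (H : LinearIndependent k ![f, g, h]) :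
    Module.finrank k (Submodule.span k {f, g}) = 2 := by
  have hcard := finrank_span_eq_card (linearIndependent_pair_of_triple H)
  rwa [Matrix.range_cons_cons_empty, Fintype.card_fin] at hcard

theorem span_pair_le_span_triple :
    Submodule.span k {f, g} ≤ Submodule.span k {f, g, h} :=
  Submodule.span_mono (by grind)

theorem span_pair_lt_of_triple (H : LinearIndependent k ![f, g, h]) :
    Submodule.span k {f, g} < Submodule.span k {f, g, h} :=
  lt_of_le_of_ne span_pair_le_span_triple fun he =>
    notMem_span_pair_of_triple H (he ▸ Submodule.subset_span (by simp))

end Triple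

section Generates

variable {C : Scheme.{0}} [C.Over (Spec (.of ℂ))] [IsSmoothProjectiveCurve C]
  {V W : Submodule ℂ C.functionField} {D D' : Divisor C} {x : {x : C // IsClosed {x}}}
  {f g w w' : C.functionField}

variable (x) in
theorem range_algebraMap_eq_placeRing :
    Set.range (algebraMap (C.presheaf.stalk x.1) C.functionField) = placeRing x :=
  rfl

theorem valuation_le_iff (hf : f ≠ 0) (hg : g ≠ 0) :
    (placeRing x).valuation f ≤ (placeRing x).valuation g ↔ C.ord g x.1 ≤ C.ord f x.1 := by
  have H := isPlaceSystem_placeRing C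
  rw [← div_le_one₀ (by simpa [zero_lt_iff] using hg), ← map_div₀,
    (placeRing x).valuation_le_one_iff, ← H.ord_nonneg_iff x (div_ne_zero hf hg),
    H.ord_div x hf hg, sub_nonneg]

theorem valuation_eq_iff (hf : f ≠ 0) (hg : g ≠ 0) :
    (placeRing x).valuation f = (placeRing x).valuation g ↔ C.ord f x.1 = C.ord g x.1 := by
  rw [le_antisymm_iff, valuation_le_iff hf hg, valuation_le_iff hg hf, and_comm, ← le_antisymm_iff]

theorem mem_lineBundleStalk_iff (hw : w ≠ 0) (h : C.ord w x.1 = -D x) :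
    f ∈ lineBundleStalk D x ↔ (placeRing x).valuation f ≤ (placeRing x).valuation w := by
  rw [lineBundleStalk, Set.mem_ofPred_eq]
  by_cases hf : f = 0
  · simp [hf]
  · rw [valuation_le_iff hf hw, h]
    simp only [hf, false_or]
    omega

variable (x) in
theorem exists_ord_eq (n : ℤ) : ∃ t : C.functionField, t ≠ 0 ∧ C.ord t x.1 = n := by
  obtain ⟨t, ht0, ht⟩ := exists_ord_eq_one x.2
  refine ⟨t ^ n, zpow_ne_zero n ht0, ?_⟩
  rw [(isPlaceSystem_placeRing C).ord_zpow x ht0, ht, mul_one]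

/-- `w` is a local generator at `x` of the line bundle generated by `W`: a nonzero element of `W`
of largest valuation at `x`, that is, of smallest order. -/
structure IsLocalGenerator (W : Submodule ℂ C.functionField) (x : {x : C // IsClosed {x}})
    (w : C.functionField) : Prop where
  mem : w ∈ W
  ne_zero : w ≠ 0
  valuation_le : ∀ v ∈ W, (placeRing x).valuation v ≤ (placeRing x).valuation w

theorem IsLocalGenerator.valuation_eq (h : IsLocalGenerator W x w) (h' : IsLocalGenerator W x w') :
    (placeRing x).valuation w = (placeRing x).valuation w' :=
  le_antisymm (h'.valuation_le w h.mem) (h.valuation_le w' h'.mem)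

theorem IsLocalGenerator.of_le (h : IsLocalGenerator V x w) (hWV : W ≤ V) (hw' : w' ∈ W)
    (heq : (placeRing x).valuation w' = (placeRing x).valuation w) : IsLocalGenerator W x w' where
  mem := hw'
  ne_zero := by
    rintro rfl
    exact h.ne_zero ((map_eq_zero _).1 (heq.symm.trans (map_zero _)))
  valuation_le v hv := heq ▸ h.valuation_le v (hWV hv)

theorem generates_iff :
    Generates W D ↔ ∀ x, ∃ w, IsLocalGenerator W x w ∧ C.ord w x.1 = -D x := by
  refine forall_congr' fun x => ⟨fun h => ?_, fun ⟨w, hw, hord⟩ => ?_⟩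
  · obtain ⟨t, ht0, ht⟩ := exists_ord_eq x (-D x)
    have hWt : ∀ v ∈ W, (placeRing x).valuation v ≤ (placeRing x).valuation t := fun v hv =>
      (mem_lineBundleStalk_iff ht0 ht).1 (h.le (Submodule.subset_span hv))
    obtain ⟨w, hw, htw⟩ : ∃ w ∈ W, (placeRing x).valuation t ≤ (placeRing x).valuation w := by
      by_contra! hlt
      have htspan : t ∈ Submodule.span (C.presheaf.stalk x.1) (W : Set C.functionField) :=
        h.ge ((mem_lineBundleStalk_iff ht0 ht).2 le_rfl)
      exact lt_irrefl _ (valuation_lt_of_mem_span (A := placeRing x) (fun c => ⟨c, rfl⟩) ht0 hlt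
        htspan)
    have hwt := le_antisymm (hWt w hw) htw
    have hw0 : w ≠ 0 := by
      rintro rfl
      exact ht0 ((map_eq_zero _).1 (hwt.symm.trans (map_zero _)))
    exact ⟨w, ⟨hw, hw0, fun v hv => hwt ▸ hWt v hv⟩, ((valuation_eq_iff hw0 ht0).1 hwt).trans ht⟩
  · rw [span_eq_setOf_valuation_le (range_algebraMap_eq_placeRing x) hw.mem hw.ne_zero
      hw.valuation_le]
    exact Set.ext fun f => (mem_lineBundleStalk_iff hw.ne_zero hord).symm

theorem IsLocalGenerator.ord_eq (h : IsLocalGenerator W x w) (hD : Generates W D) :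
    C.ord w x.1 = -D x := by
  obtain ⟨w', hw', hord⟩ := generates_iff.1 hD x
  rw [← hord, ← valuation_eq_iff h.ne_zero hw'.ne_zero, h.valuation_eq hw']

theorem eq_of_generates (h : Generates W D) (h' : Generates W D') : D = D' := by
  ext x
  obtain ⟨w, hw, hord⟩ := generates_iff.1 h x
  exact neg_injective (hord.symm.trans (hw.ord_eq h'))

theorem exists_isLocalGenerator_span_pair (x : {x : C // IsClosed {x}}) (hf : f ≠ 0) (hg : g ≠ 0) :
    ∃ w, IsLocalGenerator (Submodule.span ℂ {f, g}) x w ∧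
      C.ord w x.1 = min (C.ord f x.1) (C.ord g x.1) := by
  wlog hfg : C.ord f x.1 ≤ C.ord g x.1 generalizing f g
  · rw [Set.pair_comm, min_comm]
    exact this hg hf (le_of_not_ge hfg)
  refine ⟨f, ⟨Submodule.subset_span (by simp), hf, fun v hv => ?_⟩, (min_eq_left hfg).symm⟩
  refine valuation_le_of_mem_span (algebraMap_mem_placeRing x) ?_ hv
  rintro _ (rfl | rfl)
  exacts [le_rfl, (valuation_le_iff hg hf).2 hfg]

theorem generates_span_pair_iff (hf : f ≠ 0) (hg : g ≠ 0) :
    Generates (Submodule.span ℂ {f, g}) D ↔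
      ∀ x, D x = -min (C.ord f x.1) (C.ord g x.1) := by
  refine ⟨fun h x => ?_, fun h => generates_iff.2 fun x => ?_⟩ <;>
    obtain ⟨w, hw, hord⟩ := exists_isLocalGenerator_span_pair x hf hg
  · rw [← hord, hw.ord_eq h, neg_neg]
  · exact ⟨w, hw, by rw [hord, h, neg_neg]⟩

theorem exists_generates_span_pair (H : LinearIndependent ℂ ![f, g]) :
    ∃ D : Divisor C, Generates (Submodule.span ℂ {f, g}) D ∧
      D.degree = Module.finrank (IntermediateField.adjoin ℂ {g / f}) C.functionField := by
  have hf : f ≠ 0 := H.ne_zero 0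
  have hg : g ≠ 0 := H.ne_zero 1
  obtain ⟨hfin, hsum⟩ := (isPlaceSystem_placeRing C).finsum_neg_min_ord
    (fun _ => finiteDimensional_functionField) hg hf (transcendental_div_of_linearIndependent H)
  refine ⟨Finsupp.ofSupportFinite _ hfin, (generates_span_pair_iff hf hg).2 fun x => ?_, ?_⟩
  · rw [Finsupp.ofSupportFinite_coe, min_comm]
  · rw [← hsum]
    exact (finsum_eq_sum_of_support_subset _
      (Finsupp.fun_support_eq (Finsupp.ofSupportFinite _ hfin)).le).symm

theorem degree_eq_finrank (H : LinearIndependent ℂ ![f, g])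
    (h : Generates (Submodule.span ℂ {f, g}) D) :
    D.degree = Module.finrank (IntermediateField.adjoin ℂ {g / f}) C.functionField := by
  obtain ⟨D', hD', hdeg⟩ := exists_generates_span_pair H
  rw [eq_of_generates h hD', hdeg]

end Generates

section Pencils

variable {C : Scheme.{0}} [C.Over (Spec (.of ℂ))] [IsSmoothProjectiveCurve C]
  {D D' : Divisor C} {f g h : C.functionField} {p : MvPolynomial (Fin 2) ℂ}

theorem Generates.of_le {V W : Submodule ℂ C.functionField} (hD : Generates V D) (hWV : W ≤ V)
    (hW : ∀ x w, IsLocalGenerator V x w →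
      ∃ w' ∈ W, (placeRing x).valuation w ≤ (placeRing x).valuation w') : Generates W D := by
  refine generates_iff.2 fun x => ?_
  obtain ⟨w, hw, hord⟩ := generates_iff.1 hD x
  obtain ⟨w', hw', hle⟩ := hW x w hw
  have heq := le_antisymm (hw.valuation_le w' (hWV hw')) hle
  have hgen := hw.of_le hWV hw' heq
  exact ⟨w', hgen, ((valuation_eq_iff hgen.ne_zero hw.ne_zero).1 heq).trans hord⟩

/-- At a base point of the pencil the centre `(a₀, a₁)` would be the value of the coordinates
`(f / h, g / h)`, so it would lie on the curve `p = 0`. -/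
theorem generates_span_pair_of_eval_ne_zero (hh : h ≠ 0)
    (hp : MvPolynomial.aeval ![f / h, g / h] p = 0) {a : Fin 2 → ℂ}
    (ha : MvPolynomial.eval a p ≠ 0) (hD : Generates (Submodule.span ℂ {f, g, h}) D) :
    Generates (Submodule.span ℂ {f - a 0 • h, g - a 1 • h}) D := by
  rw [← span_triple_sub (a 0) (a 1)] at hD
  refine hD.of_le span_pair_le_span_triple fun x w hw => ?_
  by_contra! hlt
  have hA := algebraMap_mem_placeRing x
  have hf := hlt (f - a 0 • h) (Submodule.subset_span (by simp))
  have hg := hlt (g - a 1 • h) (Submodule.subset_span (by simp))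
  have hwh : (placeRing x).valuation w ≤ (placeRing x).valuation h := by
    by_contra! hhw
    refine lt_irrefl _ (valuation_lt_of_mem_span hA hw.ne_zero ?_ hw.mem)
    rintro _ (rfl | rfl | rfl)
    exacts [hf, hg, hhw]
  refine ha (eval_eq_zero_of_aeval_eq_zero hA (fun i => ?_) hp)
  fin_cases i
  exacts [(valuation_div_sub_algebraMap_lt_one_iff hh f (a 0)).2 (hf.trans_le hwh),
    (valuation_div_sub_algebraMap_lt_one_iff hh g (a 1)).2 (hg.trans_le hwh)]

theorem degree_eq_totalDegree (H : LinearIndependent ℂ ![f, g, h]) (hp0 : p ≠ 0)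
    (hp : RingHom.ker (MvPolynomial.aeval (R := ℂ) ![f / h, g / h]) = Ideal.span {p})
    (hK : IntermediateField.adjoin ℂ {f / h, g / h} = ⊤)
    (hD : Generates (Submodule.span ℂ {f, g, h}) D) : D.degree = p.totalDegree := by
  obtain ⟨a, ha⟩ := exists_eval_ne_zero hp0
  have hh : h ≠ 0 := H.ne_zero 2
  have H' := linearIndependent_pair_of_triple (linearIndependent_triple_sub H (a 0) (a 1))
  have hf : f - a 0 • h ≠ 0 := H'.ne_zero 0
  have hdiv : (![f / h, g / h] 1 - algebraMap ℂ C.functionField (a 1)) /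
      (![f / h, g / h] 0 - algebraMap ℂ C.functionField (a 0)) =
        (g - a 1 • h) / (f - a 0 • h) := by
    simp only [Matrix.cons_val_zero, Matrix.cons_val_one]
    rw [div_sub_algebraMap hh, div_sub_algebraMap hh, div_div_div_cancel_right₀ hh]
  have hp' : MvPolynomial.aeval ![f / h, g / h] p = 0 :=
    RingHom.mem_ker.1 (hp.ge (Ideal.mem_span_singleton_self p))
  have hslope := finrank_adjoin_slope_of_eval_ne_zero (w := ![f / h, g / h]) (a := a)
    (by simpa only [Matrix.cons_val_zero, div_sub_algebraMap hh] using div_ne_zero hf hh)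
    (by rw [hdiv]; exact transcendental_div_of_linearIndependent H')
    (by rwa [Matrix.range_cons_cons_empty]) hp ha
  rw [hdiv] at hslope
  rw [degree_eq_finrank H' (generates_span_pair_of_eval_ne_zero hh hp' ha hD), hslope]

theorem exists_generates_degree_add_eq (H : LinearIndependent ℂ ![f, g, h]) (hp0 : p ≠ 0)
    (hp : RingHom.ker (MvPolynomial.aeval (R := ℂ) ![f / h, g / h]) = Ideal.span {p})
    (hK : IntermediateField.adjoin ℂ {f / h, g / h} = ⊤)
    (hD : Generates (Submodule.span ℂ {f, g, h}) D) :
    ∃ D' : Divisor C, Generates (Submodule.span ℂ {f, g}) D' ∧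
      D'.degree + orderAtOrigin p = D.degree := by
  have hh : h ≠ 0 := H.ne_zero 2
  have H' := linearIndependent_pair_of_triple H
  have hf : f ≠ 0 := H'.ne_zero 0
  obtain ⟨D', hD', hdeg⟩ := exists_generates_span_pair H'
  have hdiv : g / h / (f / h) = g / f := div_div_div_cancel_right₀ hh _ _
  have hslope := finrank_adjoin_slope_add_orderAtOrigin (div_ne_zero hf hh)
    (by rw [hdiv]; exact transcendental_div_of_linearIndependent H') hK hp0 hp
  rw [hdiv] at hslope
  refine ⟨D', hD', ?_⟩
  rw [degree_eq_totalDegree H hp0 hp hK hD, hdeg, ← hslope, Nat.cast_add]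

variable {x : {x : C // IsClosed {x}}}

theorem mem_span_pair_of_valuation_lt {e : C.functionField} (hh : h ≠ 0)
    (hf : (placeRing x).valuation f < (placeRing x).valuation h)
    (hg : (placeRing x).valuation g < (placeRing x).valuation h)
    (he : (placeRing x).valuation e < (placeRing x).valuation h)
    (hmem : e ∈ Submodule.span ℂ {f, g, h}) : e ∈ Submodule.span ℂ {f, g} := by
  by_contra hnot
  rw [Set.pair_comm g h, Set.insert_comm] at hmem
  refine lt_irrefl _ (valuation_lt_of_mem_span (algebraMap_mem_placeRing x) hh ?_
    (mem_span_insert_exchange hmem hnot))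
  rintro _ (rfl | rfl | rfl)
  exacts [he, hf, hg]

theorem isLocalGenerator_span_triple (hh : h ≠ 0)
    (hf : (placeRing x).valuation f < (placeRing x).valuation h)
    (hg : (placeRing x).valuation g < (placeRing x).valuation h) :
    IsLocalGenerator (Submodule.span ℂ {f, g, h}) x h where
  mem := Submodule.subset_span (by simp)
  ne_zero := hh
  valuation_le v hv := by
    refine valuation_le_of_mem_span (algebraMap_mem_placeRing x) ?_ hv
    rintro _ (rfl | rfl | rfl)
    exacts [hf.le, hg.le, le_rfl]

theorem eq_span_pair_of_divisor_ne (H : LinearIndependent ℂ ![f, g, h])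
    (hf : (placeRing x).valuation f < (placeRing x).valuation h)
    (hg : (placeRing x).valuation g < (placeRing x).valuation h)
    (hD : Generates (Submodule.span ℂ {f, g, h}) D) {W : Submodule ℂ C.functionField}
    (hWV : W ≤ Submodule.span ℂ {f, g, h}) (hW : Module.finrank ℂ W = 2) (hD' : Generates W D')
    (hne : D' x ≠ D x) : W = Submodule.span ℂ {f, g} := by
  have hh : h ≠ 0 := H.ne_zero 2
  have hgen := isLocalGenerator_span_triple hh hf hg
  have hlt : ∀ e ∈ W, (placeRing x).valuation e < (placeRing x).valuation h := fun e he => by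
    refine lt_of_le_of_ne (hgen.valuation_le e (hWV he)) fun heq => hne (neg_injective ?_)
    have hgenW := hgen.of_le hWV he heq
    rw [← hgenW.ord_eq hD', ← hgen.ord_eq hD, ← valuation_eq_iff hgenW.ne_zero hh, heq]
  have : FiniteDimensional ℂ (Submodule.span ℂ {f, g}) := .span_of_finite ℂ (Set.toFinite _)
  exact Submodule.eq_of_le_of_finrank_eq
    (fun e he => mem_span_pair_of_valuation_lt hh hf hg (hlt e he) (hWV he))
    (hW.trans (finrank_span_pair_of_triple H).symm)

end Pencils

section Multiplicity

variable {C : Scheme.{0}} [C.Over (Spec (.of ℂ))] [IsSmoothProjectiveCurve C]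
  {D D' : Divisor C} {V : Submodule ℂ C.functionField} {b : Module.Basis (Fin 3) ℂ V}
  {φ : C ⟶ Plane}

theorem span_range_basis {k K ι : Type*} [Field k] [AddCommGroup K] [Module k K]
    {V : Submodule k K} (b : Module.Basis ι k V) :
    Submodule.span k (Set.range fun i => (b i : K)) = V := by
  have hspan := congrArg (Submodule.map V.subtype) b.span_eq
  rwa [Submodule.map_span, ← Set.range_comp, Submodule.map_top, Submodule.range_subtype] at hspan

/-- `f / h` and `g / h` are affine coordinates of the plane with origin at the image of `x`. -/
theorem exists_centred_basis (hφ : IsMapOfSeries b φ) (hbir : IsBirationalMorphism φ.toImage)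
    (x : {x : C // IsClosed {x}}) :
    ∃ f g h : C.functionField, LinearIndependent ℂ ![f, g, h] ∧ Submodule.span ℂ {f, g, h} = V ∧
      (placeRing x).valuation f < (placeRing x).valuation h ∧
      (placeRing x).valuation g < (placeRing x).valuation h ∧
      IntermediateField.adjoin ℂ {f / h, g / h} = ⊤ ∧
      ∀ p, RingHom.ker (MvPolynomial.aeval (R := ℂ) ![f / h, g / h]) = Ideal.span {p} →
        imageMultiplicity φ (φ.toImage x.1) = orderAtOrigin p := by
  obtain ⟨j, hj⟩ := exists_mem_basicOpen_X (φ x.1)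
  obtain ⟨a, ha⟩ := exists_coordinates_mem_maximalIdeal hφ x.2 hj
  let s : Fin 3 → C.functionField := fun i => b i
  have hs : LinearIndependent ℂ s := b.linearIndependent.map' V.subtype V.ker_subtype
  have hh : s j ≠ 0 := hs.ne_zero j
  have hcoord : (fun i => s (j.succAbove i) / s j - algebraMap ℂ C.functionField (a i)) =
      ![(s (j.succAbove 0) - a 0 • s j) / s j, (s (j.succAbove 1) - a 1 • s j) / s j] := by
    funext i
    fin_cases i <;> exact div_sub_algebraMap hh _ _
  have hval (i : Fin 2) : (placeRing x).valuation (s (j.succAbove i) - a i • s j) <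
      (placeRing x).valuation (s j) := by
    obtain ⟨r, hr, hri⟩ := ha i
    rw [← valuation_div_sub_algebraMap_lt_one_iff hh]
    exact hri ▸ valuation_algebraMap_lt_one (IsFractionRing.injective _ _)
      (range_algebraMap_eq_placeRing x) hr
  refine ⟨_, _, s j, linearIndependent_triple_sub (linearIndependent_triple_succAbove hs j) _ _,
    (span_triple_sub _ _).trans ((span_triple_succAbove s j).trans (span_range_basis b)),
    hval 0, hval 1, ?_, fun p hp => imageMultiplicity_toImage hφ hj ha ?_⟩
  · rw [← Matrix.range_cons_cons_empty, ← hcoord, adjoin_range_sub_algebraMap a]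
    exact adjoin_coordinates_eq_top hφ hbir hj
  · rw [← hp, ← hcoord]

/-- The pencil is cut out by the lines through the image of `x`. -/
theorem exists_pencil (hgen : Generates V D) (hφ : IsMapOfSeries b φ)
    (hbir : IsBirationalMorphism φ.toImage) (x : {x : C // IsClosed {x}}) :
    ∃ (W : Submodule ℂ C.functionField) (D₀ : Divisor C),
      W < V ∧ Module.finrank ℂ W = 2 ∧ Generates W D₀ ∧
      D₀.degree + imageMultiplicity φ (φ.toImage x.1) = D.degree ∧
      ∀ W' ≤ V, Module.finrank ℂ W' = 2 → ∀ D', Generates W' D' → D' x ≠ D x → W' = W := by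
  obtain ⟨f, g, h, H, rfl, hf, hg, hK, hmul⟩ := exists_centred_basis hφ hbir x
  have hslope : Transcendental ℂ (![f / h, g / h] 0) := by
    have Hhf : LinearIndependent ℂ ![h, f] := LinearIndependent.pair_iff.2 fun y z hyz => by
      obtain ⟨hz, -, hy⟩ := linearIndependent_triple_iff.1 H z 0 y (by rw [← hyz]; module)
      exact ⟨hy, hz⟩
    exact transcendental_div_of_linearIndependent Hhf
  obtain ⟨p, hp0, hp⟩ := exists_ker_aeval_eq_span
    (not_algebraicIndependent_of_trdeg_le_one (trdeg_functionField_le_one C) ![f / h, g / h]) hslope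
  obtain ⟨D₀, hD₀, hdeg⟩ := exists_generates_degree_add_eq H hp0 hp hK hgen
  exact ⟨Submodule.span ℂ {f, g}, D₀, span_pair_lt_of_triple H, finrank_span_pair_of_triple H, hD₀,
    hmul p hp ▸ hdeg, fun W' hW' hr D' hD' hne =>
      eq_span_pair_of_divisor_ne H hf hg hgen hW' hr hD' hne⟩

theorem isClosed_toImage (hφ : IsMapOfSeries b φ) {x : C} (hx : IsClosed {x}) :
    IsClosed {φ.toImage x} := by
  have := universallyClosed_of_genericCoordinates hφ
  have : UniversallyClosed φ.toImage := inferInstance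
  rw [← Set.image_singleton]
  exact φ.toImage.isClosedMap _ hx

theorem exists_toImage_eq (hφ : IsMapOfSeries b φ) {p : φ.image} (hp : IsClosed {p}) :
    ∃ x, IsClosed {x} ∧ φ.toImage x = p := by
  have := compactSpace_curve C
  obtain ⟨x, hx, hxc⟩ := (hp.preimage φ.toImage.continuous).exists_closed_singleton
    (toImage_surjective hφ p)
  exact ⟨x, hxc, hx⟩

variable (C) in
theorem exists_isClosed_singleton : ∃ x : C, IsClosed {x} := by
  have := compactSpace_curve C
  obtain ⟨x, -, hx⟩ := isClosed_univ.exists_closed_singleton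
    (S := (Set.univ : Set C)) ⟨genericPoint C, trivial⟩
  exact ⟨x, hx⟩

theorem finrank_eq_two_of_lt {k K : Type*} [Field k] [AddCommGroup K] [Module k K]
    {V W : Submodule k K} (b : Module.Basis (Fin 3) k V) (hWV : W < V)
    (hW : 2 ≤ Module.finrank k W) : Module.finrank k W = 2 := by
  have : FiniteDimensional k V := b.finiteDimensional_of_finite
  have hlt := Submodule.finrank_lt_finrank_of_lt hWV
  rw [Module.finrank_eq_card_basis b, Fintype.card_fin] at hlt
  omega

theorem degree_eq_or_exists_add_imageMultiplicity_eq (hgen : Generates V D)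
    (hφ : IsMapOfSeries b φ) (hbir : IsBirationalMorphism φ.toImage)
    {W : Submodule ℂ C.functionField} (hWV : W < V) (hW : Module.finrank ℂ W = 2)
    (hD' : Generates W D') :
    D'.degree = D.degree ∨
      ∃ p : φ.image, IsClosed {p} ∧ D'.degree + imageMultiplicity φ p = D.degree := by
  by_cases hDD : D' = D
  · exact .inl (congrArg _ hDD)
  obtain ⟨x, hx⟩ := DFunLike.ne_iff.1 hDD
  obtain ⟨W₀, D₀, -, -, hD₀, hdeg, huniq⟩ := exists_pencil hgen hφ hbir x
  obtain rfl := huniq W hWV.le hW D' hD' hx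
  exact .inr ⟨φ.toImage x.1, isClosed_toImage hφ x.2, eq_of_generates hD' hD₀ ▸ hdeg⟩

theorem forall_degree_div_rk_iff (hgen : Generates V D) (hφ : IsMapOfSeries b φ)
    (hbir : IsBirationalMorphism φ.toImage) {P : ℚ → Prop} (hP : Monotone P) :
    (∀ W : Submodule ℂ C.functionField, W < V → 2 ≤ Module.finrank ℂ W →
      ∀ D' : Divisor C, Generates W D' → P ((D'.degree : ℚ) / (rk W : ℚ))) ↔
    ∀ p : φ.image, IsClosed {p} → P (D.degree - imageMultiplicity φ p) := by
  have hrk {W : Submodule ℂ C.functionField} (hW : Module.finrank ℂ W = 2) (d : ℚ) :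
      d / (rk W : ℚ) = d := by
    rw [rk, hW]
    norm_num
  constructor
  · intro hpencil p hp
    obtain ⟨x, hx, rfl⟩ := exists_toImage_eq hφ hp
    obtain ⟨W, D₀, hWV, hW, hD₀, hdeg, -⟩ := exists_pencil hgen hφ hbir ⟨x, hx⟩
    have hPW := hpencil W hWV hW.ge D₀ hD₀
    rwa [hrk hW, eq_sub_of_add_eq hdeg, Int.cast_sub, Int.cast_natCast] at hPW
  · intro hmult W hWV hrkW D' hD'
    have hW := finrank_eq_two_of_lt b hWV hrkW
    rw [hrk hW]
    rcases degree_eq_or_exists_add_imageMultiplicity_eq hgen hφ hbir hWV hW hD' with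
      hdeg | ⟨p, hp, hdeg⟩
    · obtain ⟨x, hx⟩ := exists_isClosed_singleton C
      rw [hdeg]
      exact hP (sub_le_self _ (Nat.cast_nonneg _)) (hmult _ (isClosed_toImage hφ hx))
    · rw [eq_sub_of_add_eq hdeg, Int.cast_sub, Int.cast_natCast]
      exact hmult p hp

end Multiplicity

end LinearSeries

end

theorem mainTheorem3
    (C : Scheme.{0}) [C.Over (Spec (.of ℂ))] [LinearSeries.IsSmoothProjectiveCurve C]
    (D : LinearSeries.Divisor C) (V : Submodule ℂ C.functionField)
    (hV : (V : Set C.functionField) ⊆ LinearSeries.globalSections D)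
    (hrk : LinearSeries.rk V = 2)
    (hgen : LinearSeries.Generates V D)
    (b : Module.Basis (Fin 3) ℂ V)
    (φ : C ⟶ LinearSeries.Plane) (hφ : LinearSeries.IsMapOfSeries b φ)
    (hbir : LinearSeries.IsBirationalMorphism φ.toImage) :
    (LinearSeries.IsLinearlyStable D V ↔
      ∀ p : φ.image, IsClosed {p} →
        (LinearSeries.imageMultiplicity φ p : ℚ) < (D.degree : ℚ) / 2) ∧
    (LinearSeries.IsLinearlySemistable D V ↔
      ∀ p : φ.image, IsClosed {p} →
        (LinearSeries.imageMultiplicity φ p : ℚ) ≤ (D.degree : ℚ) / 2) := by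
  rw [LinearSeries.IsLinearlyStable, LinearSeries.IsLinearlySemistable, hrk, Int.cast_ofNat]
  constructor
  · refine (LinearSeries.forall_degree_div_rk_iff hgen hφ hbir (P := ((D.degree : ℚ) / 2 < ·))
      fun _ _ hle hlt => hlt.trans_le hle).trans (forall₂_congr fun p _ => ?_)
    constructor <;> intro h <;> linarith
  · refine (LinearSeries.forall_degree_div_rk_iff hgen hφ hbir (P := ((D.degree : ℚ) / 2 ≤ ·))
      fun _ _ hle hlt => hlt.trans hle).trans (forall₂_congr fun p _ => ?_)
    constructor <;> intro h <;> linarith
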